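/- **Setting.** Let $\mathcal T=[a,b]$ with $-\infty<a<b<\infty$, let $k$ be the number of samples, and let the sample sizes $n_1,\dots,n_k\ge 2$, $n=\sum_i n_i$, run through a sequence with $n\to\infty$. The data are $k$ independent functional samples $y_{ij}(t)=\eta_i(t)+v_{ij}(t)$, $t\in\mathcal T$, $1\le j\le n_i$, $1\le i\le k$, where $\eta_i\in L^2(\mathcal T)$ and $v_{i1},\dots,v_{in_i}$ are i.i.d. (jointly measurable) processes with mean $0$ and covariance function $\gamma_i(s,t)$, $\operatorname{tr}(\gamma_i)=\int_{\mathcal T}\gamma_i(t,t)\,dt<\infty$. Put $$\bar y_i=\frac1{n_i}\sum_j y_{ij},\quad \hat\gamma_i(s,t)=\frac1{n_i-1}\sum_{j}[y_{ij}(s)-\bar y_i(s)][y_{ij}(t)-\bar y_i(t)],\quad \hat\gamma=\frac1{n-k}\sum_i(n_i-1)\hat\gamma_i,$$ $$T_n=\sum_{i=1}^k(n_i-1)\int_{\mathcal T}\int_{\mathcal T}[\hat\gamma_i(s,t)-\hat\gamma(s,t)]^2\,ds\,dt .$$ For a kernel $g$ on $\mathcal T$ let $\varpi_g[(s_1,t_1),(s_2,t_2)]=g(s_1,s_2)g(t_1,t_2)+g(s_1,t_2)g(s_2,t_1)$,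 $\operatorname{tr}(g^{\otimes2})=\iint g^2$, $\operatorname{tr}(g^{\otimes4})=\int\!\!\int\!\!\int\!\!\int g(t,u_1)g(u_1,u_2)g(u_2,u_3)g(u_3,t)\,du_1du_2du_3dt$, $\operatorname{tr}(\varpi_g)=\iint\varpi_g[(s,t),(s,t)]\,ds\,dt$ and $\operatorname{tr}(\varpi_g^{\otimes2})=\int\!\!\int\!\!\int\!\!\int\varpi_g^2$. Let $$\hat\beta=\frac{B}{A},\qquad \hat\kappa=\frac{A^2}{B},$$ where either (naive method) $A=\operatorname{tr}(\varpi_{\hat\gamma})$, $B=\operatorname{tr}(\varpi_{\hat\gamma}^{\otimes2})$, or (bias-reduced method) $A=a_1+a_2$, $B=2a_2^2+2\operatorname{tr}(\hat\gamma^{\otimes4})$ with $$a_1=\tfrac{(n-k)(n-k+1)}{(n-k-1)(n-k+2)}\Big[\operatorname{tr}^2(\hat\gamma)-\tfrac{2\operatorname{tr}(\hat\gamma^{\otimes2})}{n-k+1}\Big],\qquad a_2=\tfrac{(n-k)^2}{(n-k-1)(n-k+2)}\Big[\operatorname{tr}(\hat\gamma^{\otimes2})-\tfrac{\operatorname{tr}^2(\hat\gamma)}{n-k}\Big]$$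 (a quotient with denominator $0$ is read as $0$). For $0<\alpha<1$ let $\chi^2_d(\alpha)$ be the upper $100\alpha$-percentile of the $\chi^2$ distribution with $d\ge 0$ (real) degrees of freedom, and let $\hat T_n(\alpha)=\hat\beta\,\chi^2_{(k-1)\hat\kappa}(\alpha)$. The $L^2$-norm test rejects the equality of $\gamma_1,\dots,\gamma_k$ when $T_n>\hat T_n(\alpha)$. **Assumptions.** (A1) The processes $y_{ij}$ are Gaussian. (A2) $n_i/n\to\tau_i\in(0,1)$ for every $i$. (A3) The functions $\gamma_i(s,t)$ are bounded, uniformly in $i$, $s$, $t$ and along the sequence of sample sizes. (H1) $\gamma_i=\gamma+(n_i-1)^{-1/2}d_i$, $i=1,\dots,k$, where $\gamma$ is a fixed measurable covariance function with $\operatorname{tr}(\gamma)<\infty$. Put $\mathbf W_n=\mathbf I_k-\mathbf b_n\mathbf b_n^T/(n-k)$ with $\mathbf b_n=(\sqrt{n_1-1},\dots,\sqrt{n_k-1})^T$ and $\mathbf W=\mathbf I_k-\mathbf b\mathbf b^T$ with $\mathbf b=(\sqrt{\tau_1},\dots,\sqrt{\tau_k})^T$, so that $\mathbf W_n\to\mathbf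 W$. Let $\mathbf U$ be orthogonal with $\mathbf W=\mathbf U\,\mathrm{diag}(\mathbf I_{k-1},0)\,\mathbf U^T$, let $(\phi_r)_{r\ge1}$ be an orthonormal basis of $L^2(\mathcal T^2)$ that consists of eigenfunctions of the integral operator with kernel $\varpi_\gamma$, let $\mathbf d=(d_1,\dots,d_k)^T$, $\tilde{\mathbf d}=[\mathbf I_{k-1},\mathbf 0]\mathbf U^T\mathbf d$ and $$\delta_r^2=\Big\|\int_{\mathcal T}\int_{\mathcal T}\tilde{\mathbf d}(s,t)\phi_r(s,t)\,ds\,dt\Big\|^2,\qquad r=1,2,\dots$$ **Theorem 5.** Under (A1)–(A3) and (H1) the $L^2$-norm test, with either method of estimation, has asymptotic power $1$ when $\max_r\delta_r^2\to\infty$, in both of the following senses. 1. ($\mathbf d$ independent of $n$.) Let $\mathbf d^{(1)},\mathbf d^{(2)},\dots$ be such that for each fixed $m$ the assumptions hold, for all large $n$, with $\mathbf d=\mathbf d^{(m)}$ (in (A3) the bound may depend on $m$). If $\max_r\delta_r^2(\mathbf d^{(m)})\to\infty$ as $m\to\infty$, then $$\lim_{m\to\infty}\ \liminf_{n\to\infty}\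 P_{\mathbf d^{(m)}}\big(T_n>\hat T_n(\alpha)\big)=1 .$$ 2. ($\mathbf d=\mathbf d_n$ varying with $n$.) If $\max_r\delta_r^2(\mathbf d_n)\to\infty$ as $n\to\infty$ and $$\iint\|(\mathbf W_n-\mathbf W)\mathbf d_n(s,t)\|^2\,ds\,dt=o\big(\max_r\delta_r^2(\mathbf d_n)\big),$$ then $P\big(T_n>\hat T_n(\alpha)\big)\to1$ as $n\to\infty$. -/

import Mathlib

open MeasureTheory ProbabilityTheory Filter Topology

attribute [local instance] Measure.Subtype.measureSpace

universe u

noncomputable section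

namespace ECF

/-! ### Statistics computed from `k` functional samples

The data are `x i j : T → ℝ`, the `j`-th curve (`j < N i`) of the `i`-th sample. -/

section Statistics

variable {T : Type*} {k : ℕ} {N : Fin k → ℕ}

/-- The total sample size `n = ∑ i, n_i`. -/
def totalSize (N : Fin k → ℕ) : ℕ := ∑ i, N i

/-- The group sample mean function `ȳ_i(t)`. -/
def sampleMean (x : (i : Fin k) → Fin (N i) → T → ℝ) (i : Fin k) (t : T) : ℝ :=
  (N i : ℝ)⁻¹ * ∑ j, x i j t

/-- The group sample covariance function `γ̂_i(s, t)`. -/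
def sampleCov (x : (i : Fin k) → Fin (N i) → T → ℝ) (i : Fin k) (s t : T) : ℝ :=
  ((N i : ℝ) - 1)⁻¹ *
    ∑ j, (x i j s - sampleMean x i s) * (x i j t - sampleMean x i t)

/-- The pooled sample covariance function `γ̂(s, t)`. -/
def pooledCov (x : (i : Fin k) → Fin (N i) → T → ℝ) (s t : T) : ℝ :=
  (∑ i, ((N i : ℝ) - 1) * sampleCov x i s t) / ((totalSize N : ℝ) - k)

/-- The kernel `ϖ[(s₁,t₁),(s₂,t₂)] = g(s₁,s₂) g(t₁,t₂) + g(s₁,t₂) g(s₂,t₁)`. -/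
def varpi (g : T → T → ℝ) (p q : T × T) : ℝ :=
  g p.1 q.1 * g p.2 q.2 + g p.1 q.2 * g q.1 p.2

variable [MeasureSpace T]

/-- `T_n = ∑ i, (n_i - 1) ∫∫ (γ̂_i(s,t) - γ̂(s,t))² ds dt`. -/
def testStat (x : (i : Fin k) → Fin (N i) → T → ℝ) : ℝ :=
  ∑ i, ((N i : ℝ) - 1) * ∫ s, ∫ t, (sampleCov x i s t - pooledCov x s t) ^ 2

/-- `tr(g) = ∫ g(t,t) dt`. -/
def tr (g : T → T → ℝ) : ℝ := ∫ t, g t t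

/-- `tr(g^{⊗2}) = ∫∫ g(s,t)² ds dt`. -/
def trTwo (g : T → T → ℝ) : ℝ := ∫ s, ∫ t, g s t ^ 2

/-- `tr(g^{⊗4}) = ∫∫∫∫ g(t,u₁) g(u₁,u₂) g(u₂,u₃) g(u₃,t) du₁ du₂ du₃ dt`. -/
def trFour (g : T → T → ℝ) : ℝ :=
  ∫ t, ∫ u₁, ∫ u₂, ∫ u₃, g t u₁ * g u₁ u₂ * g u₂ u₃ * g u₃ t

/-- `tr(w) = ∫∫ w[(s,t),(s,t)] ds dt` for a kernel `w` on `T × T`. -/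
def trPair (w : T × T → T × T → ℝ) : ℝ := ∫ s, ∫ t, w (s, t) (s, t)

/-- `tr(w^{⊗2}) = ∫∫∫∫ w[(s₁,t₁),(s₂,t₂)]² ds₁ dt₁ ds₂ dt₂` for a kernel `w` on `T × T`. -/
def trPairTwo (w : T × T → T × T → ℝ) : ℝ :=
  ∫ s₁, ∫ t₁, ∫ s₂, ∫ t₂, w (s₁, t₁) (s₂, t₂) ^ 2

/-- The bias-reduced estimator of `tr²(γ)`. -/
def brTrSq (x : (i : Fin k) → Fin (N i) → T → ℝ) : ℝ :=
  let M : ℝ := (totalSize N : ℝ) - k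
  M * (M + 1) / ((M - 1) * (M + 2)) *
    (tr (pooledCov x) ^ 2 - 2 * trTwo (pooledCov x) / (M + 1))

/-- The bias-reduced estimator of `tr(γ^{⊗2})`. -/
def brTrTwo (x : (i : Fin k) → Fin (N i) → T → ℝ) : ℝ :=
  let M : ℝ := (totalSize N : ℝ) - k
  M ^ 2 / ((M - 1) * (M + 2)) *
    (trTwo (pooledCov x) - tr (pooledCov x) ^ 2 / M)

/-- The two methods of estimating the parameters of the approximating `χ²` distribution. -/
inductive Method
  | naive
  | biasReduced

/-- The estimator of `tr(ϖ)`. -/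
def estTr (x : (i : Fin k) → Fin (N i) → T → ℝ) : Method → ℝ
  | .naive => trPair (varpi (pooledCov x))
  | .biasReduced => brTrSq x + brTrTwo x

/-- The estimator of `tr(ϖ^{⊗2})`. -/
def estTrTwo (x : (i : Fin k) → Fin (N i) → T → ℝ) : Method → ℝ
  | .naive => trPairTwo (varpi (pooledCov x))
  | .biasReduced => 2 * brTrTwo x ^ 2 + 2 * trFour (pooledCov x)

def betaHat (x : (i : Fin k) → Fin (N i) → T → ℝ) (me : Method) : ℝ :=
  estTrTwo x me / estTr x me

def kappaHat (x : (i : Fin k) → Fin (N i) → T → ℝ) (me : Method) : ℝ :=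
  estTr x me ^ 2 / estTrTwo x me

/-- The `χ²` distribution with a real number `d` of degrees of freedom, i.e. the Gamma
distribution of shape `d / 2` and rate `1 / 2`; the point mass at `0` if `d = 0`. -/
def chiSquare (d : ℝ) : Measure ℝ :=
  if 0 < d then gammaMeasure (d / 2) (1 / 2) else Measure.dirac 0

/-- The upper `100α`-percentile `χ²_d(α)`. -/
def chiSquareUpper (d α : ℝ) : ℝ := sInf {c : ℝ | 1 - α ≤ cdf (chiSquare d) c}

/-- The estimated critical value `T̂_n(α) = β̂ χ²_{(k-1)κ̂}(α)`. -/
def critValue (x : (i : Fin k) → Fin (N i) → T → ℝ) (me : Method) (α : ℝ) : ℝ :=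
  betaHat x me * chiSquareUpper (((k : ℝ) - 1) * kappaHat x me) α

end Statistics

/-! ### The statistical model and its assumptions -/

section Model

variable {T : Type*} [MeasureSpace T] {k : ℕ}

/-- A measurable covariance function of finite trace. -/
structure IsCovFun (γ : T → T → ℝ) : Prop where
  measurable : Measurable (Function.uncurry γ)
  posSemidef : ∀ (m : ℕ) (t : Fin m → T), (Matrix.of fun i j => γ (t i) (t j)).PosSemidef
  trace : Integrable (fun t => γ t t)

/-- `k` independent functional samples `y_ij(t) = η_i(t) + v_ij(t)`, where
`v_i1, …, v_in_i` are i.i.d. measurable stochastic processes with mean function `0` and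
covariance function `Γ i` of finite trace, and `η_i ∈ L²`. -/
structure IsFunctionalSamples {Ω : Type u} [MeasurableSpace Ω] (P : Measure Ω) {N : Fin k → ℕ}
    (y : (i : Fin k) → Fin (N i) → T → Ω → ℝ) (η : Fin k → T → ℝ)
    (Γ : Fin k → T → T → ℝ) : Prop where
  measurable : ∀ i j, Measurable (Function.uncurry (y i j))
  mean_memLp : ∀ i, MemLp (η i) 2
  memLp : ∀ i j t, MemLp (fun ω => y i j t ω - η i t) 2 P
  mean_zero : ∀ i j t, ∫ ω, (y i j t ω - η i t) ∂P = 0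
  cov_eq : ∀ i j s t, cov[fun ω => y i j s ω - η i s, fun ω => y i j t ω - η i t; P] = Γ i s t
  trace : ∀ i, Integrable (fun t => Γ i t t)
  indep : iIndepFun (fun (p : (i : Fin k) × Fin (N i)) ω t => y p.1 p.2 t ω) P
  identDistrib : ∀ i j j', IdentDistrib (fun ω t => y i j t ω) (fun ω t => y i j' t ω) P P

/-- The samples are Gaussian. -/
def GaussianSamples {Ω : Type u} [MeasurableSpace Ω] (P : Measure Ω) {N : Fin k → ℕ}
    (y : (i : Fin k) → Fin (N i) → T → Ω → ℝ) : Prop :=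
  ∀ i j, IsGaussianProcess (y i j) P

/-- The sample sizes `n ν i` (at least two, so that the sample covariance functions exist) satisfy
`n → ∞` and `n_i / n → τ_i ∈ (0, 1)`, as the step `ν` tends to infinity. -/
structure ProportionalSizes (n : ℕ → Fin k → ℕ) (τ : Fin k → ℝ) : Prop where
  two_le : ∀ ν i, 2 ≤ n ν i
  total : Tendsto (fun ν => totalSize (n ν)) atTop atTop
  mem_Ioo : ∀ i, τ i ∈ Set.Ioo (0 : ℝ) 1
  ratio : ∀ i, Tendsto (fun ν => (n ν i : ℝ) / totalSize (n ν)) atTop (𝓝 (τ i))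

/-- The covariance functions `Γ ν i` are uniformly bounded. -/
def UniformlyBounded (Γ : ℕ → Fin k → T → T → ℝ) : Prop :=
  ∃ C : ℝ, ∀ ν i s t, |Γ ν i s t| ≤ C

/-- The local alternative `γ_i(s,t) = γ(s,t) + (n_i - 1)^{-1/2} d_i(s,t)`. -/
def localAlt (γ : T → T → ℝ) (N : Fin k → ℕ) (d : Fin k → T → T → ℝ) (i : Fin k) (s t : T) : ℝ :=
  γ s t + (√((N i : ℝ) - 1))⁻¹ * d i s t

end Model

/-! ### The quantities `δ_r²` -/

section Delta

variable {T : Type*} [MeasureSpace T] {k : ℕ}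

/-- `W_n = I_k - b_n b_nᵀ / (n - k)` with `b_n = (√(n_1 - 1), …, √(n_k - 1))`. -/
def WMatN (N : Fin k → ℕ) : Matrix (Fin k) (Fin k) ℝ :=
  1 - ((totalSize N : ℝ) - k)⁻¹ •
    Matrix.vecMulVec (fun i => √((N i : ℝ) - 1)) (fun i => √((N i : ℝ) - 1))

/-- `W = I_k - b bᵀ` with `b = (√τ_1, …, √τ_k)`. -/
def WMat (τ : Fin k → ℝ) : Matrix (Fin k) (Fin k) ℝ :=
  1 - Matrix.vecMulVec (fun i => √(τ i)) (fun i => √(τ i))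

/-- `U` is orthogonal and `W = U diag(I_{k-1}, 0) Uᵀ`. -/
def IsDecomposition (τ : Fin k → ℝ) (U : Matrix (Fin k) (Fin k) ℝ) : Prop :=
  U ∈ Matrix.orthogonalGroup (Fin k) ℝ ∧
    WMat τ = U * Matrix.diagonal (fun l : Fin k => if l.val + 1 < k then (1 : ℝ) else 0) *
      U.transpose

/-- `d̃(s,t) = [I_{k-1}, 0] Uᵀ d(s,t)`. -/
def dTilde (U : Matrix (Fin k) (Fin k) ℝ) (d : Fin k → T → T → ℝ) (p : T × T) :
    Fin (k - 1) → ℝ :=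
  fun l => (U.transpose.mulVec fun i => d i p.1 p.2) (Fin.castLE (Nat.sub_le k 1) l)

/-- A complete orthonormal system of eigenfunctions `φ_r` in `L²(T × T)`, with eigenvalues
`ev r`, of the integral operator with kernel `ϖ`. The null space of the operator contains
all antisymmetric functions, so a complete system cannot be listed by decreasing eigenvalues when
infinitely many of them are positive; no order is imposed. -/
def IsEigensystem (γ : T → T → ℝ) (ev : ℕ → ℝ)
    (φ : HilbertBasis ℕ ℝ (Lp ℝ 2 (volume : Measure (T × T)))) : Prop :=
  ∀ r, ∀ᵐ p : T × T, ∫ q : T × T, varpi γ p q * (φ r : T × T → ℝ) q = ev r * (φ r : T × T → ℝ) p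

/-- `δ_r² = ‖∫∫ d̃(s,t) φ_r(s,t) ds dt‖²`, with the Euclidean norm of `ℝ^{k-1}`. -/
def deltaSq (U : Matrix (Fin k) (Fin k) ℝ)
    (φ : HilbertBasis ℕ ℝ (Lp ℝ 2 (volume : Measure (T × T))))
    (d : Fin k → T → T → ℝ) (r : ℕ) : ℝ :=
  ∑ l, (∫ p : T × T, dTilde U d p l * (φ r : T × T → ℝ) p) ^ 2

/-- `max_r δ_r²` (the `δ_r²` are summable over `r` by Bessel's inequality). -/
def maxDeltaSq (U : Matrix (Fin k) (Fin k) ℝ)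
    (φ : HilbertBasis ℕ ℝ (Lp ℝ 2 (volume : Measure (T × T))))
    (d : Fin k → T → T → ℝ) : ℝ :=
  ⨆ r, deltaSq U φ d r

/-- `∫∫ ‖A d(s,t)‖² ds dt`, with the Euclidean norm of `ℝ^k`. -/
def normSqField (A : Matrix (Fin k) (Fin k) ℝ) (d : Fin k → T → T → ℝ) : ℝ :=
  ∑ i, ∫ p : T × T, (A.mulVec (fun j => d j p.1 p.2) i) ^ 2

end Delta

/-- The event that the test rejects, `T_n > T̂_n(α)`. -/
def rejects {T : Type*} [MeasureSpace T] {k : ℕ} {N : Fin k → ℕ} {Ω : Type u}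
    (y : (i : Fin k) → Fin (N i) → T → Ω → ℝ) (me : Method) (α : ℝ) : Set Ω :=
  {ω | critValue (fun i j t => y i j t ω) me α < testStat (fun i j t => y i j t ω)}

end ECF

end

namespace ECF

/-! ### The critical value -/

/-! The critical value stays bounded in probability, while `T_n` grows with the part of `d` that `W`
retains. No limit law and no consistency of the estimators is needed.

Critical value: Markov's inequality gives `χ²_d(α) ≤ d / α`. Since `β̂ κ̂ = A`, the critical value
is at most `(k - 1) |A| / α` (`critValue_le`), and `|A| ≤ 8 tr²(γ̂)` for both methods
(`abs_estTr_le`). The mean of `tr(γ̂)` is at most twice a common bound on the traces of the `γ_i`.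

Test statistic: with `e_i = √(n_i - 1) (γ̂_i - γ_i)`, `T_n` is the integral of `‖W_n (e + d)‖²`. As
`W_n` is a contraction, `‖W d‖² ≤ 4 T_n + 4 ‖e‖² + 2 ‖(W_n - W) d‖²` in `L²`
(`normSqField_le_testStat`). Gaussian fourth moments bound the mean of `‖e‖²` independently of the
sample sizes (`integral_sq_sum_mul_sub_le`), and `max_r δ_r² ≤ ‖W d‖²` by Cauchy–Schwarz
(`maxDeltaSq_le`).

Hence, outside an event of probability at most `C / R`, the test rejects once `max_r δ_r²` exceeds
an explicit function of `R` plus `2 ‖(W_n - W) d‖²` (`one_sub_le_measure_rejects`). This holds for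
finite samples and uniformly over models with bounded traces (`exists_threshold`), so both orders of
limits follow from it. -/

lemma mul_gammaPDF {a r : ℝ} (ha : 0 < a) (hr : 0 < r) (x : ℝ) :
    ENNReal.ofReal x * gammaPDF a r x = ENNReal.ofReal (a / r) * gammaPDF (a + 1) r x := by
  rcases lt_or_ge x 0 with hx | hx
  · simp [gammaPDF_of_neg hx]
  · rw [gammaPDF_of_nonneg hx, gammaPDF_of_nonneg hx, ← ENNReal.ofReal_mul hx,
      ← ENNReal.ofReal_mul (by positivity)]
    congr 1
    have hG : Real.Gamma a ≠ 0 := (Real.Gamma_pos_of_pos ha).ne'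
    rw [Real.Gamma_add_one ha.ne', Real.rpow_add_one hr.ne', add_sub_cancel_right]
    rcases hx.eq_or_lt with rfl | hx
    · simp [Real.zero_rpow ha.ne']
    · rw [Real.rpow_sub_one hx.ne']
      field_simp

/-- The factor `x` turns the density of shape `a` into `a / r` times the density of shape `a + 1`,
which has total mass one. -/
lemma lintegral_id_gammaMeasure {a r : ℝ} (ha : 0 < a) (hr : 0 < r) :
    ∫⁻ x, ENNReal.ofReal x ∂(gammaMeasure a r) = ENNReal.ofReal (a / r) := by
  have hm : ∀ c : ℝ, Measurable (gammaPDF c r) := fun c =>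
    (measurable_gammaPDFReal c r).ennreal_ofReal
  rw [gammaMeasure, lintegral_withDensity_eq_lintegral_mul _ (hm a) (by fun_prop)]
  simp only [Pi.mul_apply, mul_comm (gammaPDF a r _), mul_gammaPDF ha hr]
  rw [lintegral_const_mul _ (hm _), lintegral_gammaPDF_eq_one (by positivity) hr, mul_one]

instance isProbabilityMeasure_chiSquare (d : ℝ) : IsProbabilityMeasure (chiSquare d) := by
  unfold chiSquare
  split_ifs with h
  · exact isProbabilityMeasure_gammaMeasure (by positivity) (by positivity)
  · infer_instance

lemma lintegral_id_chiSquare (d : ℝ) :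
    ∫⁻ x, ENNReal.ofReal x ∂(chiSquare d) = ENNReal.ofReal (max d 0) := by
  unfold chiSquare
  split_ifs with h
  · rw [lintegral_id_gammaMeasure (by positivity) (by positivity), max_eq_left h.le]
    congr 1
    ring
  · simp [lintegral_dirac, max_eq_right (not_lt.1 h)]

/-- This bounds the set defining `chiSquareUpper` below by `0`: for `c < 0` the cdf vanishes and so
is less than `1 - α`. -/
lemma chiSquare_Iio_zero (d : ℝ) : chiSquare d (Set.Iio 0) = 0 := by
  unfold chiSquare
  split_ifs with h
  · rw [gammaMeasure, withDensity_apply _ measurableSet_Iio]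
    exact lintegral_gammaPDF_of_nonpos le_rfl
  · simp

lemma cdf_chiSquare_of_neg (d : ℝ) {c : ℝ} (hc : c < 0) : cdf (chiSquare d) c = 0 := by
  rw [cdf_eq_real, measureReal_def,
    measure_mono_null (Set.Iic_subset_Iio.2 hc) (chiSquare_Iio_zero d)]
  rfl

lemma chiSquareUpper_nonneg {d α : ℝ} (hα : α < 1) : 0 ≤ chiSquareUpper d α := by
  refine Real.sInf_nonneg fun c hc => ?_
  by_contra! h
  rw [Set.mem_ofPred_eq, cdf_chiSquare_of_neg d h] at hc
  linarith

/-- The Markov inequality bounds a quantile by the mean. -/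
lemma chiSquareUpper_le {d α : ℝ} (hα₀ : 0 < α) (hα : α < 1) :
    chiSquareUpper d α ≤ max d 0 / α := by
  refine csInf_le ⟨0, fun c hc => ?_⟩ ?_
  · by_contra! h
    rw [Set.mem_ofPred_eq, cdf_chiSquare_of_neg d h] at hc
    linarith
  · set m := max d 0 with hm
    have hm0 : 0 ≤ m := le_max_right _ _
    have key : (chiSquare d).real (Set.Ioi (m / α)) ≤ α := by
      -- For `m = 0` the threshold is `0` and Markov's inequality says nothing; the law is then the
      -- point mass at `0`.
      rcases hm0.eq_or_lt with h0 | hpos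
      · have hd : ¬ 0 < d := fun h => by
          have := le_max_left d 0
          linarith
        simp [← h0, chiSquare, hd, measureReal_def, hα₀.le]
      · rw [measureReal_def]
        refine ENNReal.toReal_le_of_le_ofReal hα₀.le ?_
        calc chiSquare d (Set.Ioi (m / α))
            ≤ chiSquare d {x | ENNReal.ofReal (m / α) ≤ ENNReal.ofReal x} :=
              measure_mono fun x hx => ENNReal.ofReal_le_ofReal (le_of_lt hx)
          _ ≤ (∫⁻ x, ENNReal.ofReal x ∂(chiSquare d)) / ENNReal.ofReal (m / α) :=
              meas_ge_le_lintegral_div (by fun_prop)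
                (by simpa using div_pos hpos hα₀) ENNReal.ofReal_ne_top
          _ = ENNReal.ofReal α := by
              rw [lintegral_id_chiSquare, ← hm, ← ENNReal.ofReal_div_of_pos (div_pos hpos hα₀)]
              congr 1
              field_simp
    have hc := probReal_compl_eq_one_sub (μ := chiSquare d) (measurableSet_Ioi (a := m / α))
    rw [Set.compl_Ioi] at hc
    rw [Set.mem_ofPred_eq, cdf_eq_real, hc]
    linarith

/-! ### Deterministic bounds for the critical value and algebra of the estimators -/

section Deterministic

variable {T : Type*} {k : ℕ} {N : Fin k → ℕ}

/-- Bounding the quantile by its mean makes `B` cancel in `β̂ κ̂ = A`, so `B` needs no lower bound.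
If `β̂ ≤ 0`, which includes the zero denominators, the critical value is nonpositive. -/
lemma critValue_le [MeasureSpace T] (x : (i : Fin k) → Fin (N i) → T → ℝ) (me : Method)
    {α : ℝ} (hα₀ : 0 < α) (hα : α < 1) (hk : 1 ≤ k) :
    critValue x me α ≤ ((k : ℝ) - 1) * |estTr x me| / α := by
  have hk' : (0 : ℝ) ≤ (k : ℝ) - 1 := by
    have : (1 : ℝ) ≤ k := by exact_mod_cast hk
    linarith
  have hrhs : 0 ≤ ((k : ℝ) - 1) * |estTr x me| / α := by positivity
  unfold critValue
  rcases le_or_gt (betaHat x me) 0 with hβ | hβ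
  · exact (mul_nonpos_of_nonpos_of_nonneg hβ (chiSquareUpper_nonneg hα)).trans hrhs
  · have hA : estTr x me ≠ 0 := by
      rintro h
      simp [betaHat, h] at hβ
    have hB : estTrTwo x me ≠ 0 := by
      rintro h
      simp [betaHat, h] at hβ
    calc betaHat x me * chiSquareUpper (((k : ℝ) - 1) * kappaHat x me) α
        ≤ betaHat x me * (max (((k : ℝ) - 1) * kappaHat x me) 0 / α) :=
          mul_le_mul_of_nonneg_left (chiSquareUpper_le hα₀ hα) hβ.le
      _ = max (betaHat x me * (((k : ℝ) - 1) * kappaHat x me)) 0 / α := by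
          rw [← mul_div_assoc, mul_max_of_nonneg _ _ hβ.le, mul_zero]
      _ = max (((k : ℝ) - 1) * estTr x me) 0 / α := by
          congr 2
          rw [betaHat, kappaHat]
          field_simp
      _ ≤ _ := by
          gcongr
          refine max_le ?_ (by positivity)
          gcongr
          exact le_abs_self _

/-- A kernel that is dominated on the diagonal, as every covariance function is. -/
structure IsDiagDominated (g : T → T → ℝ) : Prop where
  nonneg : ∀ t, 0 ≤ g t t
  sq_le : ∀ s t, g s t ^ 2 ≤ g s s * g t t

/-- Only the majorant has to be integrable: a nonnegative function that is not integrable has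
integral `0` by convention. -/
lemma integral_integral_le_tr_sq [MeasureSpace T] {g h : T → T → ℝ} {C : ℝ}
    (hg : Integrable fun t => g t t) (h0 : ∀ s t, 0 ≤ h s t)
    (hle : ∀ s t, h s t ≤ C * (g s s * g t t)) :
    0 ≤ ∫ s, ∫ t, h s t ∧ ∫ s, ∫ t, h s t ≤ C * tr g ^ 2 := by
  refine ⟨integral_nonneg fun s => integral_nonneg fun t => h0 s t, ?_⟩
  have h1 : ∀ s, ∫ t, h s t ≤ C * tr g * g s s := fun s =>
    calc ∫ t, h s t ≤ ∫ t, C * g s s * g t t :=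
          integral_mono_of_nonneg (.of_forall fun t => h0 s t) (hg.const_mul _)
            (.of_forall fun t => (hle s t).trans_eq (by ring))
      _ = C * tr g * g s s := by rw [integral_const_mul, tr]; ring
  calc ∫ s, ∫ t, h s t ≤ ∫ s, C * tr g * g s s :=
        integral_mono_of_nonneg (.of_forall fun s => integral_nonneg fun t => h0 s t)
          (hg.const_mul _) (.of_forall h1)
    _ = C * tr g ^ 2 := by rw [integral_const_mul, ← tr]; ring

/-- Diagonal domination gives `q = tr(γ̂^{⊗2}) ≤ p = tr²(γ̂)`. For `M ≥ 2` both prefactors of the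
bias-reduced estimator are at most `2`, so each summand is at most `2 (p + q) ≤ 4 p`. -/
lemma abs_estTr_le [MeasureSpace T] (x : (i : Fin k) → Fin (N i) → T → ℝ) (me : Method)
    (hg : IsDiagDominated (pooledCov x)) (hint : Integrable fun t => pooledCov x t t)
    (hM : (2 : ℝ) ≤ (totalSize N : ℝ) - k) :
    |estTr x me| ≤ 8 * tr (pooledCov x) ^ 2 := by
  cases me with
  | naive =>
    have h := integral_integral_le_tr_sq (g := pooledCov x)
      (h := fun s t => varpi (pooledCov x) (s, t) (s, t)) (C := 2) hint
      (fun s t => add_nonneg (mul_nonneg (hg.nonneg s) (hg.nonneg t)) (mul_self_nonneg _))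
      (fun s t => by
        have := hg.sq_le s t
        simp only [varpi]
        nlinarith)
    simp only [estTr, trPair]
    rw [abs_of_nonneg h.1]
    have := sq_nonneg (tr (pooledCov x))
    linarith [h.2]
  | biasReduced =>
    have h := integral_integral_le_tr_sq (g := pooledCov x)
      (h := fun s t => pooledCov x s t ^ 2) (C := 1) hint
      (fun s t => sq_nonneg _) (fun s t => by simpa using hg.sq_le s t)
    simp only [estTr, brTrSq, brTrTwo, trTwo]
    set q := ∫ s, ∫ t, pooledCov x s t ^ 2
    set p := tr (pooledCov x) ^ 2
    set M := (totalSize N : ℝ) - k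
    have hp : 0 ≤ p := sq_nonneg _
    obtain ⟨hq0, hqp⟩ := h
    rw [one_mul] at hqp
    have hD : 0 < (M - 1) * (M + 2) := by nlinarith
    have f1 : M * (M + 1) / ((M - 1) * (M + 2)) ≤ 2 := by
      rw [div_le_iff₀ hD]; nlinarith
    have f1' : 0 ≤ M * (M + 1) / ((M - 1) * (M + 2)) := by positivity
    have f2 : M ^ 2 / ((M - 1) * (M + 2)) ≤ 2 := by
      rw [div_le_iff₀ hD]; nlinarith
    have f2' : 0 ≤ M ^ 2 / ((M - 1) * (M + 2)) := by positivity
    have g1 : |p - 2 * q / (M + 1)| ≤ p + q := by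
      have e1 : 0 ≤ 2 * q / (M + 1) := by positivity
      have e2 : 2 * q / (M + 1) ≤ q := by
        rw [div_le_iff₀ (by linarith)]; nlinarith
      rw [abs_le]; constructor <;> linarith
    have g2 : |q - p / M| ≤ p + q := by
      have e1 : 0 ≤ p / M := by positivity
      have e2 : p / M ≤ p := div_le_self hp (by linarith)
      rw [abs_le]; constructor <;> linarith
    refine (abs_add_le _ _).trans ?_
    rw [abs_mul, abs_mul, abs_of_nonneg f1', abs_of_nonneg f2']
    have := mul_le_mul f1 g1 (abs_nonneg _) (by norm_num)
    have := mul_le_mul f2 g2 (abs_nonneg _) (by norm_num)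
    linarith

/-! ### Algebra of the sample covariance functions -/

lemma sampleMean_sub (x : (i : Fin k) → Fin (N i) → T → ℝ) (c : Fin k → T → ℝ) {i : Fin k}
    (hN : 1 ≤ N i) (t : T) :
    sampleMean (fun i j t => x i j t - c i t) i t = sampleMean x i t - c i t := by
  have : (N i : ℝ) ≠ 0 := by positivity
  simp only [sampleMean, Finset.sum_sub_distrib, Finset.sum_const, Finset.card_univ,
    Fintype.card_fin, nsmul_eq_mul]
  field_simp

/-- Centring at the group mean cancels any common shift; in the model this removes `η_i`. -/
lemma sampleCov_sub (x : (i : Fin k) → Fin (N i) → T → ℝ) (c : Fin k → T → ℝ) {i : Fin k}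
    (hN : 1 ≤ N i) (s t : T) :
    sampleCov (fun i j t => x i j t - c i t) i s t = sampleCov x i s t := by
  simp only [sampleCov, sampleMean_sub x c hN]
  simp

lemma pooledCov_sub (x : (i : Fin k) → Fin (N i) → T → ℝ) (c : Fin k → T → ℝ)
    (hN : ∀ i, 1 ≤ N i) (s t : T) :
    pooledCov (fun i j t => x i j t - c i t) s t = pooledCov x s t := by
  simp only [pooledCov, sampleCov_sub x c (hN _)]

lemma sub_one_mul_sampleCov (x : (i : Fin k) → Fin (N i) → T → ℝ) {i : Fin k} (hN : 2 ≤ N i)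
    (s t : T) :
    ((N i : ℝ) - 1) * sampleCov x i s t =
      ∑ j, (x i j s - sampleMean x i s) * (x i j t - sampleMean x i t) := by
  have : (2 : ℝ) ≤ N i := by exact_mod_cast hN
  rw [sampleCov, ← mul_assoc, mul_inv_cancel₀ (by linarith), one_mul]

lemma sum_mul_sub_mean {n : ℕ} (hn : 1 ≤ n) (X Y : Fin n → ℝ) :
    ∑ j, (X j - (n : ℝ)⁻¹ * ∑ l, X l) * (Y j - (n : ℝ)⁻¹ * ∑ l, Y l) =
      ∑ j, X j * Y j - (n : ℝ)⁻¹ * ((∑ j, X j) * ∑ j, Y j) := by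
  have : (n : ℝ) ≠ 0 := by positivity
  simp only [sub_mul, mul_sub, Finset.sum_sub_distrib, ← Finset.sum_mul, ← Finset.mul_sum,
    Finset.sum_const, Finset.card_univ, Fintype.card_fin, nsmul_eq_mul]
  field_simp
  ring

lemma sub_one_mul_sampleCov' (x : (i : Fin k) → Fin (N i) → T → ℝ) {i : Fin k} (hN : 2 ≤ N i)
    (s t : T) :
    ((N i : ℝ) - 1) * sampleCov x i s t =
      ∑ j, x i j s * x i j t - (N i : ℝ)⁻¹ * ((∑ j, x i j s) * ∑ j, x i j t) := by
  rw [sub_one_mul_sampleCov x hN]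
  exact sum_mul_sub_mean (by omega) (fun j => x i j s) (fun j => x i j t)

lemma totalSize_sub (N : Fin k → ℕ) : (totalSize N : ℝ) - k = ∑ i, ((N i : ℝ) - 1) := by
  simp [totalSize, Finset.sum_sub_distrib]

lemma totalSize_sub_nonneg (hN : ∀ i, 2 ≤ N i) : 0 ≤ (totalSize N : ℝ) - k := by
  rw [totalSize_sub]
  refine Finset.sum_nonneg fun i _ => ?_
  have : (2 : ℝ) ≤ N i := by exact_mod_cast hN i
  linarith

lemma pooledCov_eq (x : (i : Fin k) → Fin (N i) → T → ℝ) (hN : ∀ i, 2 ≤ N i) (s t : T) :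
    pooledCov x s t = (∑ p : (i : Fin k) × Fin (N i), (x p.1 p.2 s - sampleMean x p.1 s) *
      (x p.1 p.2 t - sampleMean x p.1 t)) / ((totalSize N : ℝ) - k) := by
  rw [pooledCov, Fintype.sum_sigma]
  simp only [sub_one_mul_sampleCov x (hN _)]

/-- The pooled covariance is a Gram kernel of the residuals, so this is Cauchy–Schwarz over all
observations. -/
lemma isDiagDominated_pooledCov (x : (i : Fin k) → Fin (N i) → T → ℝ) (hN : ∀ i, 2 ≤ N i) :
    IsDiagDominated (pooledCov x) where
  nonneg t := by
    rw [pooledCov_eq x hN]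
    exact div_nonneg (Finset.sum_nonneg fun p _ => mul_self_nonneg _) (totalSize_sub_nonneg hN)
  sq_le s t := by
    simp only [pooledCov_eq x hN]
    rw [div_pow, div_mul_div_comm, ← pow_two ((totalSize N : ℝ) - k)]
    refine div_le_div_of_nonneg_right ?_ (sq_nonneg _)
    simp only [← pow_two]
    exact Finset.sum_mul_sq_le_sq_mul_sq _ _ _

lemma pooledCov_diag_le (x : (i : Fin k) → Fin (N i) → T → ℝ) (hN : ∀ i, 2 ≤ N i) (t : T) :
    pooledCov x t t ≤
      (∑ p : (i : Fin k) × Fin (N i), x p.1 p.2 t ^ 2) / ((totalSize N : ℝ) - k) := by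
  rw [pooledCov]
  refine div_le_div_of_nonneg_right ?_ (totalSize_sub_nonneg hN)
  rw [Fintype.sum_sigma]
  refine Finset.sum_le_sum fun i _ => ?_
  rw [sub_one_mul_sampleCov' x (hN i)]
  simp only [pow_two]
  have : 0 ≤ (N i : ℝ)⁻¹ * ((∑ j, x i j t) * ∑ j, x i j t) :=
    mul_nonneg (by positivity) (mul_self_nonneg _)
  linarith

/-- The standardized estimation error `√(n_i - 1) (γ̂_i - Γ_i)`. -/
noncomputable def covError (x : (i : Fin k) → Fin (N i) → T → ℝ) (Γ : Fin k → T → T → ℝ)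
    (i : Fin k) (p : T × T) : ℝ :=
  √((N i : ℝ) - 1) * (sampleCov x i p.1 p.2 - Γ i p.1 p.2)

lemma WMatN_mulVec (N : Fin k → ℕ) (w : Fin k → ℝ) (i : Fin k) :
    (WMatN N).mulVec w i = w i - ((totalSize N : ℝ) - k)⁻¹ *
      (√((N i : ℝ) - 1) * ∑ j, √((N j : ℝ) - 1) * w j) := by
  simp [WMatN, Matrix.sub_mulVec, Matrix.smul_mulVec, Matrix.vecMulVec_mulVec, dotProduct,
    mul_comm]

lemma sum_sqrt_mul_self (hN : ∀ i, 2 ≤ N i) :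
    ∑ i, √((N i : ℝ) - 1) * √((N i : ℝ) - 1) = (totalSize N : ℝ) - k := by
  rw [totalSize_sub]
  refine Finset.sum_congr rfl fun i _ => Real.mul_self_sqrt ?_
  have : (2 : ℝ) ≤ N i := by exact_mod_cast hN i
  linarith

/-- `W_n` is a contraction. -/
lemma sum_sq_WMatN_mulVec_le (hN : ∀ i, 2 ≤ N i) (w : Fin k → ℝ) :
    ∑ i, (WMatN N).mulVec w i ^ 2 ≤ ∑ i, w i ^ 2 := by
  simp only [WMatN_mulVec]
  set M := (totalSize N : ℝ) - k with hM
  set S := ∑ j, √((N j : ℝ) - 1) * w j with hS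
  have hM0 : 0 ≤ M := totalSize_sub_nonneg hN
  have h : ∀ i, (w i - M⁻¹ * (√((N i : ℝ) - 1) * S)) ^ 2 = w i ^ 2 -
      2 * M⁻¹ * S * (√((N i : ℝ) - 1) * w i) +
      (M⁻¹ * S) ^ 2 * (√((N i : ℝ) - 1) * √((N i : ℝ) - 1)) := fun i => by ring
  simp only [h, Finset.sum_add_distrib, Finset.sum_sub_distrib, ← Finset.mul_sum, ← hS,
    sum_sqrt_mul_self hN, ← hM]
  -- Since `‖b_n‖² = M`, the expansion reads `‖W_n w‖² = ‖w‖² - S² / M`; for `M = 0` the inverse is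
  -- `0` and `W_n` is the identity.
  rcases hM0.eq_or_lt with h0 | h0
  · simp [← h0]
  · have : (M⁻¹ * S) ^ 2 * M = M⁻¹ * S ^ 2 := by field_simp
    have : 0 ≤ M⁻¹ * S ^ 2 := by positivity
    nlinarith

/-- Pooling is averaging with weights `n_j - 1`, that is, projecting onto `b_n`. The common `γ`
enters as a multiple of `b_n`, which `W_n` kills, and the scaling of the local alternative cancels
so that `d` itself remains. -/
lemma sqrt_mul_sampleCov_sub_pooledCov (x : (i : Fin k) → Fin (N i) → T → ℝ)
    (hN : ∀ i, 2 ≤ N i) (hM : 0 < (totalSize N : ℝ) - k) (γ : T → T → ℝ)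
    (d : Fin k → T → T → ℝ) (i : Fin k) (p : T × T) :
    √((N i : ℝ) - 1) * (sampleCov x i p.1 p.2 - pooledCov x p.1 p.2) =
      (WMatN N).mulVec (fun j => covError x (localAlt γ N d) j p + d j p.1 p.2) i := by
  have hb : ∀ j, √((N j : ℝ) - 1) ≠ 0 := fun j => by
    have : (2 : ℝ) ≤ N j := by exact_mod_cast hN j
    exact (Real.sqrt_pos.2 (by linarith)).ne'
  have hw : ∀ j, covError x (localAlt γ N d) j p + d j p.1 p.2 =
      √((N j : ℝ) - 1) * (sampleCov x j p.1 p.2 - γ p.1 p.2) := fun j => by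
    have := hb j
    rw [covError, localAlt]
    field_simp
    ring
  have hpool : ((totalSize N : ℝ) - k) * pooledCov x p.1 p.2 =
      ∑ j, √((N j : ℝ) - 1) * √((N j : ℝ) - 1) * sampleCov x j p.1 p.2 := by
    rw [pooledCov, mul_div_cancel₀ _ hM.ne']
    refine Finset.sum_congr rfl fun j _ => ?_
    have : (2 : ℝ) ≤ N j := by exact_mod_cast hN j
    rw [Real.mul_self_sqrt (by linarith)]
  have hsum : ∑ j, √((N j : ℝ) - 1) * (√((N j : ℝ) - 1) * (sampleCov x j p.1 p.2 - γ p.1 p.2)) =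
      ((totalSize N : ℝ) - k) * (pooledCov x p.1 p.2 - γ p.1 p.2) := by
    rw [mul_sub, hpool, ← sum_sqrt_mul_self hN, Finset.sum_mul, ← Finset.sum_sub_distrib]
    exact Finset.sum_congr rfl fun j _ => by ring
  rw [WMatN_mulVec]
  simp only [hw, hsum]
  field_simp
  ring

lemma sum_sq_le_two_mul (u w : Fin k → ℝ) :
    ∑ i, u i ^ 2 ≤ 2 * ∑ i, (w i + u i) ^ 2 + 2 * ∑ i, w i ^ 2 := by
  simp only [Finset.mul_sum, ← Finset.sum_add_distrib]
  exact Finset.sum_le_sum fun i _ => by nlinarith [sq_nonneg (2 * w i + u i)]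

/-- Write `W d = W_n d - (W_n - W) d` and `W_n d = W_n (e + d) - W_n e`. Each splitting costs a
factor `2`, and `W_n e` is no longer than `e`. -/
lemma sum_sq_WMat_mulVec_le (hN : ∀ i, 2 ≤ N i) (τ : Fin k → ℝ) (e d : Fin k → ℝ) :
    ∑ i, (WMat τ).mulVec d i ^ 2 ≤ 4 * ∑ i, (WMatN N).mulVec (fun j => e j + d j) i ^ 2 +
      4 * ∑ i, e i ^ 2 + 2 * ∑ i, (WMatN N - WMat τ).mulVec d i ^ 2 := by
  have h1 := sum_sq_le_two_mul ((WMat τ).mulVec d) ((WMatN N - WMat τ).mulVec d)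
  have h2 := sum_sq_le_two_mul ((WMatN N).mulVec d) ((WMatN N).mulVec e)
  have h3 := sum_sq_WMatN_mulVec_le hN e
  have e1 : ∀ i, (WMatN N - WMat τ).mulVec d i + (WMat τ).mulVec d i = (WMatN N).mulVec d i :=
    fun i => by simp [Matrix.sub_mulVec]
  have e2 : ∀ i, (WMatN N).mulVec e i + (WMatN N).mulVec d i =
      (WMatN N).mulVec (fun j => e j + d j) i := fun i => by
    rw [← Pi.add_apply, ← Matrix.mulVec_add]
    rfl
  simp only [e1] at h1
  simp only [e2] at h2
  linarith

end Deterministic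

/-! ### Second moments of the sample covariance of a Gaussian sample -/

/-- The fourth moment of the standard normal distribution. -/
noncomputable def gaussianFourthMoment : ℝ := ∫ x, x ^ 4 ∂(gaussianReal 0 1)

lemma gaussianFourthMoment_nonneg : 0 ≤ gaussianFourthMoment :=
  integral_nonneg fun x => by positivity

section Moments

variable {Ω : Type*} [MeasurableSpace Ω] {P : Measure Ω}

/-- A centred Gaussian variable has the law of its standard deviation times a standard normal one;
the value of the fourth moment is irrelevant. -/
lemma integral_pow_four_eq {X : Ω → ℝ} (hX : HasGaussianLaw X P) (h0 : ∫ ω, X ω ∂P = 0) :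
    ∫ ω, X ω ^ 4 ∂P = gaussianFourthMoment * Var[X; P] ^ 2 := by
  have hmap := hX.map_eq_gaussianReal
  rw [h0] at hmap
  have h1 : (gaussianReal 0 1).map (√Var[X; P] * ·) = P.map X := by
    rw [gaussianReal_map_const_mul, hmap]
    congr 1
    · simp
    · ext
      simp [Real.sq_sqrt (variance_nonneg X P), variance_nonneg X P]
  have h2 : ∫ ω, X ω ^ 4 ∂P = ∫ x, x ^ 4 ∂(P.map X) :=
    (integral_map (f := fun x : ℝ => x ^ 4) hX.aemeasurable (by fun_prop)).symm
  rw [h2, ← h1, integral_map (by fun_prop) (by fun_prop), gaussianFourthMoment]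
  simp only [mul_pow]
  rw [integral_const_mul, mul_comm]
  congr 1
  rw [show (4 : ℕ) = 2 * 2 from rfl, pow_mul, Real.sq_sqrt (variance_nonneg X P)]

lemma memLp_mul_of_hasGaussianLaw {X Y : Ω → ℝ} (hX : HasGaussianLaw X P)
    (hY : HasGaussianLaw Y P) : MemLp (fun ω => X ω * Y ω) 2 P := by
  have : ENNReal.HolderTriple 4 4 2 := ⟨by
    rw [show (4 : ENNReal) = 2 * 2 by norm_num, ENNReal.mul_inv (by simp) (by simp), ← mul_add,
      ENNReal.inv_two_add_inv_two, mul_one]⟩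
  exact (hY.memLp (p := 4) (by simp)).mul (hX.memLp (p := 4) (by simp))

/-- Cauchy–Schwarz reduces this to the fourth moments of the marginals, so no joint law of `X` and
`Y` enters. -/
lemma integral_sq_mul_sq_le {X Y : Ω → ℝ} (hX : HasGaussianLaw X P) (hY : HasGaussianLaw Y P)
    (hX0 : ∫ ω, X ω ∂P = 0) (hY0 : ∫ ω, Y ω ∂P = 0) :
    ∫ ω, (X ω * Y ω) ^ 2 ∂P ≤ gaussianFourthMoment * (Var[X; P] * Var[Y; P]) := by
  have hX2 := memLp_mul_of_hasGaussianLaw hX hX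
  have hY2 := memLp_mul_of_hasGaussianLaw hY hY
  have h := integral_mul_le_Lp_mul_Lq_of_nonneg (μ := P) Real.HolderConjugate.two_two
    (.of_forall fun ω => mul_self_nonneg (X ω)) (.of_forall fun ω => mul_self_nonneg (Y ω))
    (by simpa using hX2) (by simpa using hY2)
  have e : ∀ x : ℝ, (x * x) ^ (2 : ℝ) = x ^ 4 := fun x => by
    rw [Real.rpow_two]; ring
  simp only [e, integral_pow_four_eq hX hX0, integral_pow_four_eq hY hY0, one_div] at h
  calc ∫ ω, (X ω * Y ω) ^ 2 ∂P = ∫ ω, X ω * X ω * (Y ω * Y ω) ∂P := by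
        congr 1; ext ω; ring
    _ ≤ _ := h
    _ = √gaussianFourthMoment * √gaussianFourthMoment * (Var[X; P] * Var[Y; P]) := by
        have := gaussianFourthMoment_nonneg
        rw [show (2⁻¹ : ℝ) = 1 / 2 by norm_num, ← Real.sqrt_eq_rpow, ← Real.sqrt_eq_rpow,
          Real.sqrt_mul this, Real.sqrt_mul this, Real.sqrt_sq (variance_nonneg X P),
          Real.sqrt_sq (variance_nonneg Y P)]
        ring
    _ = _ := by rw [Real.mul_self_sqrt gaussianFourthMoment_nonneg]

/-- The quadratic `x ↦ ∫ (X + x Y)²` is nonnegative, so its discriminant is at most zero. -/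
lemma sq_integral_mul_le {X Y : Ω → ℝ} (hX : MemLp X 2 P) (hY : MemLp Y 2 P) :
    (∫ ω, X ω * Y ω ∂P) ^ 2 ≤ (∫ ω, X ω ^ 2 ∂P) * ∫ ω, Y ω ^ 2 ∂P := by
  have hXY : Integrable (fun ω => X ω * Y ω) P := hX.integrable_mul hY
  have h : ∀ x : ℝ, 0 ≤ (∫ ω, Y ω ^ 2 ∂P) * (x * x) + (2 * ∫ ω, X ω * Y ω ∂P) * x +
      ∫ ω, X ω ^ 2 ∂P := fun x => by
    have : ∫ ω, (X ω + x * Y ω) ^ 2 ∂P = (∫ ω, Y ω ^ 2 ∂P) * (x * x) +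
        (2 * ∫ ω, X ω * Y ω ∂P) * x + ∫ ω, X ω ^ 2 ∂P := by
      rw [← integral_mul_const, ← integral_const_mul, ← integral_mul_const,
        ← integral_add (hY.integrable_sq.mul_const _) ((hXY.const_mul _).mul_const _),
        ← integral_add ((hY.integrable_sq.mul_const _).fun_add ((hXY.const_mul _).mul_const _))
          hX.integrable_sq]
      congr 1
      ext ω
      ring
    rw [← this]
    exact integral_nonneg fun ω => sq_nonneg _
  have := discrim_le_zero h
  rw [discrim] at this
  nlinarith

variable {n : ℕ} {X Y : Fin n → Ω → ℝ} {σ ρ c : ℝ}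

lemma variance_sum_eq (hX : ∀ j, HasGaussianLaw (X j) P) (hσ : ∀ j, Var[X j; P] = σ)
    (hind : iIndepFun X P) : Var[fun ω => ∑ j, X j ω; P] = n * σ := by
  have : (fun ω => ∑ j, X j ω) = ∑ j, X j := by ext; simp
  rw [this, IndepFun.variance_sum (fun j _ => (hX j).memLp_two)
    (fun i _ j _ hij => hind.indepFun hij)]
  simp [hσ]

/-- The constant in the bound for the second moment of a sample covariance. -/
noncomputable def covConst : ℝ := 8 * gaussianFourthMoment + 4

lemma covConst_nonneg : 0 ≤ covConst := by
  have := gaussianFourthMoment_nonneg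
  unfold covConst
  positivity

/-- The deviation is `u - (w - c)` with `u = ∑ X_j Y_j - n c` and `w = (∑ X_j) (∑ Y_j) / n`. By
independence `u` has variance of order `n`, and `w` has a bounded second moment because the two sums
are again Gaussian. The factor `n - 1` in the bound is what the standardization of the error divides
out. -/
lemma integral_sq_sum_mul_sub_le [IsProbabilityMeasure P] (hn : 2 ≤ n)
    (hX : ∀ j, HasGaussianLaw (X j) P) (hY : ∀ j, HasGaussianLaw (Y j) P)
    (hX0 : ∀ j, ∫ ω, X j ω ∂P = 0) (hY0 : ∀ j, ∫ ω, Y j ω ∂P = 0)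
    (hσ : ∀ j, Var[X j; P] = σ) (hρ : ∀ j, Var[Y j; P] = ρ)
    (hc : ∀ j, ∫ ω, X j ω * Y j ω ∂P = c) (hcσ : c ^ 2 ≤ σ * ρ)
    (hind : iIndepFun (fun j ω => (X j ω, Y j ω)) P) :
    Integrable (fun ω => (∑ j, X j ω * Y j ω - (n : ℝ)⁻¹ * ((∑ j, X j ω) * ∑ j, Y j ω) -
        ((n : ℝ) - 1) * c) ^ 2) P ∧
      ∫ ω, (∑ j, X j ω * Y j ω - (n : ℝ)⁻¹ * ((∑ j, X j ω) * ∑ j, Y j ω) -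
        ((n : ℝ) - 1) * c) ^ 2 ∂P ≤ ((n : ℝ) - 1) * (covConst * (σ * ρ)) := by
  have hn' : (2 : ℝ) ≤ n := by exact_mod_cast hn
  have hindX : iIndepFun X P := hind.comp (fun _ p => p.1) fun _ => measurable_fst
  have hindY : iIndepFun Y P := hind.comp (fun _ p => p.2) fun _ => measurable_snd
  have hindZ : iIndepFun (fun j ω => X j ω * Y j ω) P :=
    hind.comp (fun _ p => p.1 * p.2) fun _ => by fun_prop
  have hZ : ∀ j, MemLp (fun ω => X j ω * Y j ω) 2 P := fun j =>
    memLp_mul_of_hasGaussianLaw (hX j) (hY j)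
  have hSX := iIndepFun.hasGaussianLaw_fun_sum hX hindX
  have hSY := iIndepFun.hasGaussianLaw_fun_sum hY hindY
  have hSX0 : ∫ ω, ∑ j, X j ω ∂P = 0 := by
    rw [integral_finsetSum _ fun j _ => (hX j).integrable]; simp [hX0]
  have hSY0 : ∫ ω, ∑ j, Y j ω ∂P = 0 := by
    rw [integral_finsetSum _ fun j _ => (hY j).integrable]; simp [hY0]
  have hSXY := memLp_mul_of_hasGaussianLaw hSX hSY
  have hV := integral_sq_mul_sq_le hSX hSY hSX0 hSY0
  rw [variance_sum_eq hX hσ hindX, variance_sum_eq hY hρ hindY] at hV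
  have hSZ : MemLp (fun ω => ∑ j, X j ω * Y j ω) 2 P := memLp_finsetSum _ fun j _ => hZ j
  have hSZm : ∫ ω, ∑ j, X j ω * Y j ω ∂P = n * c := by
    rw [integral_finsetSum _ fun j _ => (hZ j).integrable (by norm_num)]; simp [hc]
  have hSZv : ∫ ω, (∑ j, X j ω * Y j ω - n * c) ^ 2 ∂P ≤
      n * (gaussianFourthMoment * (σ * ρ)) := by
    rw [← hSZm, ← variance_eq_integral hSZ.aestronglyMeasurable.aemeasurable]
    have : (fun ω => ∑ j, X j ω * Y j ω) = ∑ j, fun ω => X j ω * Y j ω := by ext; simp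
    rw [this, IndepFun.variance_sum (fun j _ => hZ j) (fun i _ j _ hij => hindZ.indepFun hij)]
    calc ∑ j, Var[fun ω => X j ω * Y j ω; P]
        ≤ ∑ j : Fin n, gaussianFourthMoment * (σ * ρ) := Finset.sum_le_sum fun j _ => by
          refine (variance_le_expectation_sq (hZ j).aestronglyMeasurable).trans ?_
          have := integral_sq_mul_sq_le (hX j) (hY j) (hX0 j) (hY0 j)
          rwa [hσ, hρ] at this
      _ = _ := by simp
  have hA : MemLp (fun ω => ∑ j, X j ω * Y j ω - n * c) 2 P := hSZ.sub (memLp_const _)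
  have hB : MemLp (fun ω => (n : ℝ)⁻¹ * ((∑ j, X j ω) * ∑ j, Y j ω)) 2 P := hSXY.const_mul _
  have hD : MemLp (fun ω => ∑ j, X j ω * Y j ω - (n : ℝ)⁻¹ * ((∑ j, X j ω) * ∑ j, Y j ω) -
        ((n : ℝ) - 1) * c) 2 P := (hSZ.sub hB).sub (memLp_const _)
  refine ⟨hD.integrable_sq, ?_⟩
  have hBv : ∫ ω, ((n : ℝ)⁻¹ * ((∑ j, X j ω) * ∑ j, Y j ω)) ^ 2 ∂P ≤
      gaussianFourthMoment * (σ * ρ) := by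
    simp only [mul_pow (n : ℝ)⁻¹]
    rw [integral_const_mul]
    calc (n : ℝ)⁻¹ ^ 2 * ∫ ω, ((∑ j, X j ω) * ∑ j, Y j ω) ^ 2 ∂P
        ≤ (n : ℝ)⁻¹ ^ 2 * (gaussianFourthMoment * (n * σ * (n * ρ))) := by gcongr
      _ = _ := by field_simp
  have hσρ : 0 ≤ σ * ρ := (sq_nonneg c).trans hcσ
  have hG := mul_nonneg gaussianFourthMoment_nonneg hσρ
  calc ∫ ω, (∑ j, X j ω * Y j ω - (n : ℝ)⁻¹ * ((∑ j, X j ω) * ∑ j, Y j ω) -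
        ((n : ℝ) - 1) * c) ^ 2 ∂P
      ≤ ∫ ω, (2 * (∑ j, X j ω * Y j ω - n * c) ^ 2 +
          4 * ((n : ℝ)⁻¹ * ((∑ j, X j ω) * ∑ j, Y j ω)) ^ 2 + 4 * c ^ 2) ∂P := by
        refine integral_mono hD.integrable_sq (((hA.integrable_sq.const_mul _).add
          (hB.integrable_sq.const_mul _)).add (integrable_const _)) fun ω => ?_
        set u := ∑ j, X j ω * Y j ω - n * c with hu
        set w := (n : ℝ)⁻¹ * ((∑ j, X j ω) * ∑ j, Y j ω)
        have : ∑ j, X j ω * Y j ω - w - ((n : ℝ) - 1) * c = u - (w - c) := by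
          rw [hu]; ring
        simp only [this]
        nlinarith [sq_nonneg (u + (w - c)), sq_nonneg (w + c)]
    _ = 2 * ∫ ω, (∑ j, X j ω * Y j ω - n * c) ^ 2 ∂P +
          4 * ∫ ω, ((n : ℝ)⁻¹ * ((∑ j, X j ω) * ∑ j, Y j ω)) ^ 2 ∂P + 4 * c ^ 2 := by
        rw [integral_add ((hA.integrable_sq.const_mul _).fun_add (hB.integrable_sq.const_mul _))
          (integrable_const _), integral_add (hA.integrable_sq.const_mul _)
          (hB.integrable_sq.const_mul _), integral_const_mul, integral_const_mul]
        simp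
    _ ≤ 2 * (n * (gaussianFourthMoment * (σ * ρ))) + 4 * (gaussianFourthMoment * (σ * ρ)) +
          4 * (σ * ρ) := by gcongr
    _ ≤ _ := by
        -- For `n ≥ 2` one has `2 n + 4 ≤ 8 (n - 1)` and `4 ≤ 4 (n - 1)`; these are the constants in
        -- `covConst`.
        unfold covConst
        nlinarith

end Moments

/-! ### Lower bound for the test statistic -/

section LowerBound

variable {T : Type*} [MeasureSpace T] {k : ℕ} {N : Fin k → ℕ}

lemma memLp_mulVec {α : Type*} [MeasurableSpace α] {μ : Measure α} {m : ℕ}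
    (A : Matrix (Fin m) (Fin k) ℝ) {w : α → Fin k → ℝ} (hw : ∀ j, MemLp (fun p => w p j) 2 μ)
    (i : Fin m) : MemLp (fun p => A.mulVec (w p) i) 2 μ := by
  simp only [Matrix.mulVec, dotProduct]
  exact memLp_finsetSum _ fun j _ => (hw j).const_mul _

lemma measurable_sampleCov (x : (i : Fin k) → Fin (N i) → T → ℝ)
    (hx : ∀ i j, Measurable (x i j)) (i : Fin k) :
    Measurable fun p : T × T => sampleCov x i p.1 p.2 := by
  unfold sampleCov sampleMean
  fun_prop

lemma sum_integral_sq_WMat_mulVec_le {α : Type*} [MeasurableSpace α] {μ : Measure α}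
    (hN : ∀ i, 2 ≤ N i) (τ : Fin k → ℝ) {e d : Fin k → α → ℝ} (he : ∀ i, MemLp (e i) 2 μ)
    (hd : ∀ i, MemLp (d i) 2 μ) :
    ∑ i, ∫ p, (WMat τ).mulVec (fun j => d j p) i ^ 2 ∂μ ≤
      4 * ∑ i, ∫ p, (WMatN N).mulVec (fun j => e j p + d j p) i ^ 2 ∂μ +
      4 * ∑ i, ∫ p, e i p ^ 2 ∂μ +
      2 * ∑ i, ∫ p, (WMatN N - WMat τ).mulVec (fun j => d j p) i ^ 2 ∂μ := by
  have hF := fun i => (memLp_mulVec (WMatN N) (w := fun p j => e j p + d j p)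
      (fun j => (he j).add (hd j)) i).integrable_sq
  have hG := fun A : Matrix (Fin k) (Fin k) ℝ => fun i =>
    (memLp_mulVec A (w := fun p j => d j p) hd i).integrable_sq
  have hE := fun i => (he i).integrable_sq
  have iF := (integrable_finsetSum Finset.univ fun i _ => hF i).const_mul 4
  have iE := (integrable_finsetSum Finset.univ fun i _ => hE i).const_mul 4
  have iG := fun A => integrable_finsetSum Finset.univ fun i _ => hG A i
  have iG' := (iG (WMatN N - WMat τ)).const_mul 2
  rw [← integral_finsetSum _ fun i _ => hG _ i, ← integral_finsetSum _ fun i _ => hG _ i,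
    ← integral_finsetSum _ fun i _ => hF i, ← integral_finsetSum _ fun i _ => hE i,
    ← integral_const_mul, ← integral_const_mul, ← integral_const_mul, ← integral_add iF iE,
    ← integral_add (iF.fun_add iE) iG']
  exact integral_mono (iG _) ((iF.fun_add iE).fun_add iG') fun p =>
    sum_sq_WMat_mulVec_le hN τ _ _

lemma testStat_eq [SFinite (volume : Measure T)] (x : (i : Fin k) → Fin (N i) → T → ℝ)
    (hN : ∀ i, 2 ≤ N i) (hM : 0 < (totalSize N : ℝ) - k)
    (γ : T → T → ℝ) (d : Fin k → T → T → ℝ)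
    (hd : ∀ i, MemLp (fun p : T × T => d i p.1 p.2) 2)
    (he : ∀ i, MemLp (covError x (localAlt γ N d) i) 2) :
    testStat x = ∑ i, ∫ p : T × T, (WMatN N).mulVec
      (fun j => covError x (localAlt γ N d) j p + d j p.1 p.2) i ^ 2 := by
  refine Finset.sum_congr rfl fun i _ => ?_
  have hF := (memLp_mulVec (WMatN N)
    (w := fun (p : T × T) j => covError x (localAlt γ N d) j p + d j p.1 p.2)
      (fun j => (he j).add (hd j)) i).integrable_sq
  have h2 : (2 : ℝ) ≤ N i := by exact_mod_cast hN i
  simp only [← sqrt_mul_sampleCov_sub_pooledCov x hN hM γ d, mul_pow,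
    Real.sq_sqrt (show 0 ≤ (N i : ℝ) - 1 by linarith)] at hF ⊢
  rw [Measure.volume_eq_prod] at hF ⊢
  rw [integral_prod _ hF]
  simp only [integral_const_mul]

/-- The error bound is a lower integral, so its finiteness also supplies the square integrability
that Fubini requires in `testStat_eq`. -/
lemma normSqField_le_testStat [SFinite (volume : Measure T)]
    (x : (i : Fin k) → Fin (N i) → T → ℝ)
    (hx : ∀ i j, Measurable (x i j)) (hN : ∀ i, 2 ≤ N i) (hM : 0 < (totalSize N : ℝ) - k)
    (τ : Fin k → ℝ) (γ : T → T → ℝ) (d : Fin k → T → T → ℝ)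
    (hd : ∀ i, MemLp (fun p : T × T => d i p.1 p.2) 2)
    (hΓ : ∀ i, Measurable fun p : T × T => localAlt γ N d i p.1 p.2) {R : ℝ} (hR : 0 ≤ R)
    (he : ∫⁻ p : T × T, ENNReal.ofReal (∑ i, covError x (localAlt γ N d) i p ^ 2) ≤
      ENNReal.ofReal R) :
    normSqField (WMat τ) d ≤
      4 * testStat x + 4 * R + 2 * normSqField (WMatN N - WMat τ) d := by
  have hem : ∀ i, Measurable (covError x (localAlt γ N d) i) := fun i =>
    ((measurable_sampleCov x hx i).sub (hΓ i)).const_mul _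
  have hsum0 : ∀ p, 0 ≤ ∑ i, covError x (localAlt γ N d) i p ^ 2 := fun p =>
    Finset.sum_nonneg fun i _ => sq_nonneg _
  have hsm : Measurable fun p => ∑ i, covError x (localAlt γ N d) i p ^ 2 :=
    Finset.measurable_sum _ fun i _ => (hem i).pow_const 2
  have hsum : Integrable fun p => ∑ i, covError x (localAlt γ N d) i p ^ 2 := by
    refine ⟨hsm.aestronglyMeasurable, ?_⟩
    rw [hasFiniteIntegral_iff_ofReal (.of_forall hsum0)]
    exact he.trans_lt ENNReal.ofReal_lt_top
  have heR : ∫ p, ∑ i, covError x (localAlt γ N d) i p ^ 2 ≤ R := by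
    rw [integral_eq_lintegral_of_nonneg_ae (.of_forall hsum0) hsum.aestronglyMeasurable]
    exact ENNReal.toReal_le_of_le_ofReal hR he
  have he2 : ∀ i, MemLp (covError x (localAlt γ N d) i) 2 := fun i => by
    refine (memLp_two_iff_integrable_sq (hem i).aestronglyMeasurable).2 ?_
    refine hsum.mono' ((hem i).pow_const 2).aestronglyMeasurable (.of_forall fun p => ?_)
    rw [Real.norm_of_nonneg (sq_nonneg _)]
    exact Finset.single_le_sum (f := fun i => covError x (localAlt γ N d) i p ^ 2)
      (fun j _ => sq_nonneg _) (Finset.mem_univ i)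
  have h := sum_integral_sq_WMat_mulVec_le hN τ he2 hd
  rw [← testStat_eq x hN hM γ d hd he2,
    ← integral_finsetSum _ fun i _ => (he2 i).integrable_sq] at h
  exact h.trans (by unfold normSqField; gcongr)

/-! ### Comparison of `δ_r²` with the length of `W d` -/

lemma sum_sq_mulVec_orthogonal {U : Matrix (Fin k) (Fin k) ℝ}
    (hU : U ∈ Matrix.orthogonalGroup (Fin k) ℝ) (w : Fin k → ℝ) :
    ∑ i, U.mulVec w i ^ 2 = ∑ i, w i ^ 2 := by
  have h : ∀ z : Fin k → ℝ, ∑ i, z i ^ 2 = z ⬝ᵥ z := fun z => by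
    simp [dotProduct, pow_two]
  have hU' : U.transpose * U = 1 := by
    exact (Matrix.mem_orthogonalGroup_iff' _ _).1 hU
  rw [h, h, Matrix.dotProduct_mulVec, Matrix.vecMul_mulVec, hU', Matrix.vecMul_one]

/-- The outer `U` preserves lengths, and `diag(I_{k-1}, 0)` leaves exactly the coordinates of `Uᵀ d`
that form `d̃`. -/
lemma sum_dTilde_sq_le {τ : Fin k → ℝ} {U : Matrix (Fin k) (Fin k) ℝ}
    (hU : IsDecomposition τ U) {S : Type*} (d : Fin k → S → S → ℝ) (p : S × S) :
    ∑ l, dTilde U d p l ^ 2 ≤ ∑ i, (WMat τ).mulVec (fun j => d j p.1 p.2) i ^ 2 := by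
  rw [hU.2, ← Matrix.mulVec_mulVec, ← Matrix.mulVec_mulVec, sum_sq_mulVec_orthogonal hU.1]
  set w := U.transpose.mulVec fun j => d j p.1 p.2 with hw
  have h : ∀ l : Fin (k - 1), dTilde U d p l ^ 2 =
      (Matrix.diagonal (fun l : Fin k => if l.val + 1 < k then (1 : ℝ) else 0)).mulVec w
        (Fin.castLE (Nat.sub_le k 1) l) ^ 2 := fun l => by
    have : l.val + 1 < k := by omega
    simp [dTilde, Matrix.mulVec_diagonal, this, hw]
  simp only [h]
  refine (Finset.sum_map Finset.univ (Fin.castLEEmb (Nat.sub_le k 1)) fun i =>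
    (Matrix.diagonal (fun l : Fin k => if l.val + 1 < k then (1 : ℝ) else 0)).mulVec w i
      ^ 2).symm.trans_le ?_
  exact Finset.sum_le_sum_of_subset_of_nonneg (Finset.subset_univ _) fun _ _ _ => sq_nonneg _

/-- Each coordinate of `d̃` is paired with a unit vector of `L²`, so Cauchy–Schwarz bounds every
`δ_r²` by `‖d̃‖²`. -/
lemma maxDeltaSq_le {τ : Fin k → ℝ} {U : Matrix (Fin k) (Fin k) ℝ} (hU : IsDecomposition τ U)
    (φ : HilbertBasis ℕ ℝ (Lp ℝ 2 (volume : Measure (T × T)))) (d : Fin k → T → T → ℝ)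
    (hd : ∀ i, MemLp (fun p : T × T => d i p.1 p.2) 2) :
    maxDeltaSq U φ d ≤ normSqField (WMat τ) d := by
  have ht : ∀ l, MemLp (fun p => dTilde U d p l) 2 := fun l =>
    memLp_mulVec U.transpose (w := fun (p : T × T) j => d j p.1 p.2) hd _
  have hG : ∀ i, Integrable fun p : T × T => (WMat τ).mulVec (fun j => d j p.1 p.2) i ^ 2 :=
    fun i => (memLp_mulVec (WMat τ) (w := fun (p : T × T) j => d j p.1 p.2) hd i).integrable_sq
  refine ciSup_le fun r => ?_
  have hφ : ∫ p, (φ r : T × T → ℝ) p ^ 2 = 1 := by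
    have h1 := φ.orthonormal.1 r
    have h2 : inner ℝ (φ r) (φ r) = (1 : ℝ) := by
      rw [real_inner_self_eq_norm_sq, h1, one_pow]
    rw [L2.inner_def] at h2
    simpa [pow_two] using h2
  calc deltaSq U φ d r ≤ ∑ l, ∫ p, dTilde U d p l ^ 2 := Finset.sum_le_sum fun l _ => by
        have := sq_integral_mul_le (ht l) (Lp.memLp (φ r))
        rwa [hφ, mul_one] at this
    _ = ∫ p, ∑ l, dTilde U d p l ^ 2 :=
        (integral_finsetSum _ fun l _ => (ht l).integrable_sq).symm
    _ ≤ ∫ p : T × T, ∑ i, (WMat τ).mulVec (fun j => d j p.1 p.2) i ^ 2 :=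
        integral_mono (integrable_finsetSum _ fun l _ => (ht l).integrable_sq)
          (integrable_finsetSum _ fun i _ => hG i) fun p => sum_dTilde_sq_le hU d p
    _ = normSqField (WMat τ) d := by
        rw [integral_finsetSum _ fun i _ => hG i, normSqField]

lemma IsDiagDominated.memLp_two [SFinite (volume : Measure T)] {g : T → T → ℝ}
    (hg : IsDiagDominated g)
    (hm : Measurable (Function.uncurry g)) (hint : Integrable fun t => g t t) :
    MemLp (fun p : T × T => g p.1 p.2) 2 := by
  refine (memLp_two_iff_integrable_sq hm.aestronglyMeasurable).2 ?_
  refine (hint.mul_prod hint).mono' (hm.pow_const 2).aestronglyMeasurable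
    (.of_forall fun p => ?_)
  rw [Real.norm_of_nonneg (sq_nonneg _)]
  exact hg.sq_le p.1 p.2

lemma IsCovFun.isDiagDominated {γ : T → T → ℝ} (hγ : IsCovFun γ) : IsDiagDominated γ where
  nonneg t := by
    simpa using (hγ.posSemidef 1 fun _ => t).diag_nonneg (i := 0)
  sq_le s t := by
    have h := (hγ.posSemidef 2 ![s, t])
    have h1 := h.det_nonneg
    have h2 := h.isHermitian.apply 0 1
    simp [Matrix.det_fin_two] at h1 h2
    rw [h2] at h1
    nlinarith

/-- The test rejects as soon as the estimation errors are small compared with `max_r δ_r²`. -/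
lemma critValue_lt_testStat [SFinite (volume : Measure T)]
    (x : (i : Fin k) → Fin (N i) → T → ℝ)
    (hx : ∀ i j, Measurable (x i j)) (hN : ∀ i, 2 ≤ N i) (hk : 1 ≤ k)
    (hM : (2 : ℝ) ≤ (totalSize N : ℝ) - k)
    {τ : Fin k → ℝ} {U : Matrix (Fin k) (Fin k) ℝ} (hU : IsDecomposition τ U)
    (φ : HilbertBasis ℕ ℝ (Lp ℝ 2 (volume : Measure (T × T))))
    (γ : T → T → ℝ) (d : Fin k → T → T → ℝ)
    (hd : ∀ i, MemLp (fun p : T × T => d i p.1 p.2) 2)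
    (hΓ : ∀ i, Measurable fun p : T × T => localAlt γ N d i p.1 p.2) {R : ℝ} (hR : 0 ≤ R)
    (he : ∫⁻ p : T × T, ENNReal.ofReal (∑ i, covError x (localAlt γ N d) i p ^ 2) ≤
      ENNReal.ofReal R)
    (htr : ∫⁻ t, ENNReal.ofReal (pooledCov x t t) ≤ ENNReal.ofReal R)
    (me : Method) {α : ℝ} (hα : α ∈ Set.Ioo (0 : ℝ) 1)
    (hδ : 4 * (((k : ℝ) - 1) * (8 * R ^ 2) / α) + 4 * R +
      2 * normSqField (WMatN N - WMat τ) d < maxDeltaSq U φ d) :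
    critValue x me α < testStat x := by
  have hpd := isDiagDominated_pooledCov x hN
  have hpm : Measurable fun t => pooledCov x t t := by
    unfold pooledCov sampleCov sampleMean
    fun_prop
  have hpi : Integrable fun t => pooledCov x t t := by
    refine ⟨hpm.aestronglyMeasurable, ?_⟩
    rw [hasFiniteIntegral_iff_ofReal (.of_forall hpd.nonneg)]
    exact htr.trans_lt ENNReal.ofReal_lt_top
  have htr0 : 0 ≤ tr (pooledCov x) := integral_nonneg hpd.nonneg
  have htrR : tr (pooledCov x) ≤ R := by
    rw [tr, integral_eq_lintegral_of_nonneg_ae (.of_forall hpd.nonneg) hpm.aestronglyMeasurable]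
    exact ENNReal.toReal_le_of_le_ofReal hR htr
  have h1 := critValue_le x me hα.1 hα.2 hk
  have h2 := abs_estTr_le x me hpd hpi hM
  have h3 : tr (pooledCov x) ^ 2 ≤ R ^ 2 := pow_le_pow_left₀ htr0 htrR 2
  have h4 := normSqField_le_testStat x hx hN (by linarith) τ γ d hd hΓ hR he
  have h5 := maxDeltaSq_le hU φ d hd
  have hk' : (0 : ℝ) ≤ (k : ℝ) - 1 := by
    have : (1 : ℝ) ≤ k := by exact_mod_cast hk
    linarith
  have h6 : ((k : ℝ) - 1) * |estTr x me| / α ≤ ((k : ℝ) - 1) * (8 * R ^ 2) / α := by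
    have := hα.1
    gcongr
    linarith
  -- Here `max_r δ_r² ≤ ‖W d‖² ≤ 4 T_n + 4 R + 2 ‖(W_n - W) d‖²`, so `hδ` leaves `T_n` above the
  -- bound for the critical value.
  linarith

end LowerBound

/-! ### The model -/

section Samples

lemma lintegral_lintegral_sum_swap {ι Ω α : Type*} [Fintype ι] [MeasurableSpace Ω]
    [MeasurableSpace α] {P : Measure Ω} [SFinite P] {μ : Measure α} [SFinite μ]
    {F : ι → Ω → α → ENNReal} (hF : ∀ i, Measurable fun q : Ω × α => F i q.1 q.2) :
    ∫⁻ ω, ∫⁻ p, ∑ i, F i ω p ∂μ ∂P = ∑ i, ∫⁻ p, ∫⁻ ω, F i ω p ∂P ∂μ := by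
  rw [lintegral_lintegral_swap (f := fun ω p => ∑ i, F i ω p)
    (Finset.measurable_sum _ fun i _ => hF i).aemeasurable,
    ← lintegral_finsetSum _ fun i _ => (hF i).lintegral_prod_left']
  exact lintegral_congr fun p => lintegral_finsetSum _ fun i _ =>
    (hF i).comp measurable_prodMk_right

lemma hasGaussianLaw_centered {T : Type*} {k : ℕ} {N : Fin k → ℕ} {Ω : Type u}
    [MeasurableSpace Ω] {P : Measure Ω} {y : (i : Fin k) → Fin (N i) → T → Ω → ℝ}
    (hG : GaussianSamples P y) (η : Fin k → T → ℝ) (i : Fin k)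
    (j : Fin (N i)) (t : T) : HasGaussianLaw (fun ω => y i j t ω - η i t) P := by
  have h1 := (hG i j).hasGaussianLaw_eval t
  have h2 : HasLaw (y i j t) (gaussianReal _ _) P := ⟨h1.aemeasurable, h1.map_eq_gaussianReal⟩
  exact (gaussianReal_sub_const h2 (η i t)).hasGaussianLaw

lemma covError_eq {T Ω : Type*} {k : ℕ} {N : Fin k → ℕ}
    (y : (i : Fin k) → Fin (N i) → T → Ω → ℝ) (η : Fin k → T → ℝ)
    (Γ : Fin k → T → T → ℝ) (hN : ∀ i, 2 ≤ N i) (i : Fin k) (p : T × T) (ω : Ω) :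
    covError (fun i j t => y i j t ω) Γ i p ^ 2 = ((N i : ℝ) - 1)⁻¹ *
      (∑ j, (y i j p.1 ω - η i p.1) * (y i j p.2 ω - η i p.2) - (N i : ℝ)⁻¹ *
        ((∑ j, (y i j p.1 ω - η i p.1)) * ∑ j, (y i j p.2 ω - η i p.2)) -
        ((N i : ℝ) - 1) * Γ i p.1 p.2) ^ 2 := by
  have h2 : (2 : ℝ) ≤ N i := by exact_mod_cast hN i
  have h3 : (N i : ℝ) - 1 ≠ 0 := by linarith
  have h1 := sub_one_mul_sampleCov' (fun i j t => y i j t ω - η i t) (hN i) p.1 p.2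
  rw [sampleCov_sub (fun i j t => y i j t ω) η (by have := hN i; omega)] at h1
  rw [← h1, covError, mul_pow, Real.sq_sqrt (by linarith)]
  field_simp

variable {T : Type*} [MeasureSpace T] {k : ℕ} {N : Fin k → ℕ} {Ω : Type u} [MeasurableSpace Ω]
  {P : Measure Ω} {y : (i : Fin k) → Fin (N i) → T → Ω → ℝ}
  {η : Fin k → T → ℝ} {Γ : Fin k → T → T → ℝ}

namespace IsFunctionalSamples

lemma mean_eq [IsProbabilityMeasure P] (h : IsFunctionalSamples P y η Γ) (i : Fin k)
    (j : Fin (N i)) (t : T) : η i t = ∫ ω, y i j t ω ∂P := by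
  have h1 : Integrable (fun ω => y i j t ω - η i t) P := (h.memLp i j t).integrable (by norm_num)
  have h2 : Integrable (fun ω => y i j t ω) P := by
    simpa only [Pi.add_def, sub_add_cancel] using h1.add (integrable_const (η i t))
  have h3 := h.mean_zero i j t
  rw [integral_sub h2 (integrable_const _)] at h3
  simp at h3
  linarith

/-- Membership in `L²` gives only almost everywhere measurability; as the mean of a jointly
measurable process, `η_i` is measurable outright. -/
lemma measurable_mean [IsProbabilityMeasure P] (h : IsFunctionalSamples P y η Γ)
    (hN : ∀ i, 2 ≤ N i) (i : Fin k) : Measurable (η i) := by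
  have : η i = fun t => ∫ ω, y i ⟨0, by have := hN i; omega⟩ t ω ∂P := by
    ext t
    exact h.mean_eq i _ t
  rw [this]
  exact (h.measurable i _).stronglyMeasurable.integral_prod_right.measurable

lemma measurable_centered [IsProbabilityMeasure P] (h : IsFunctionalSamples P y η Γ)
    (hN : ∀ i, 2 ≤ N i) (i : Fin k) (j : Fin (N i)) :
    Measurable fun q : T × Ω => y i j q.1 q.2 - η i q.1 :=
  (h.measurable i j).sub ((h.measurable_mean hN i).comp measurable_fst)

lemma integral_mul_eq (h : IsFunctionalSamples P y η Γ) (i : Fin k) (j : Fin (N i)) (s t : T) :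
    ∫ ω, (y i j s ω - η i s) * (y i j t ω - η i t) ∂P = Γ i s t := by
  rw [← h.cov_eq i j s t, covariance, h.mean_zero, h.mean_zero]
  simp

lemma measurable_cov [IsProbabilityMeasure P] (h : IsFunctionalSamples P y η Γ)
    (hN : ∀ i, 2 ≤ N i) (i : Fin k) : Measurable fun p : T × T => Γ i p.1 p.2 := by
  let j : Fin (N i) := ⟨0, by have := hN i; omega⟩
  have hv := h.measurable_centered hN i j
  simp only [← h.integral_mul_eq i j]
  have h1 : Measurable fun q : (T × T) × Ω =>
      (y i j q.1.1 q.2 - η i q.1.1) * (y i j q.1.2 q.2 - η i q.1.2) :=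
    (hv.comp ((measurable_fst.comp measurable_fst).prodMk measurable_snd)).mul
      (hv.comp ((measurable_snd.comp measurable_fst).prodMk measurable_snd))
  exact (StronglyMeasurable.integral_prod_right (f := fun (p : T × T) ω =>
    (y i j p.1 ω - η i p.1) * (y i j p.2 ω - η i p.2)) h1.stronglyMeasurable).measurable

lemma integral_sq_eq (h : IsFunctionalSamples P y η Γ) (i : Fin k) (j : Fin (N i)) (t : T) :
    ∫ ω, (y i j t ω - η i t) ^ 2 ∂P = Γ i t t := by
  simp only [pow_two, h.integral_mul_eq i j]

lemma isDiagDominated (h : IsFunctionalSamples P y η Γ) (hN : ∀ i, 2 ≤ N i) (i : Fin k) :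
    IsDiagDominated (Γ i) where
  nonneg t := by
    rw [← h.integral_sq_eq i ⟨0, by have := hN i; omega⟩ t]
    exact integral_nonneg fun ω => sq_nonneg _
  sq_le s t := by
    have hj : 0 < N i := by have := hN i; omega
    rw [← h.integral_sq_eq i ⟨0, hj⟩ t, ← h.integral_sq_eq i ⟨0, hj⟩ s,
      ← h.integral_mul_eq i ⟨0, hj⟩ s t]
    exact sq_integral_mul_le (h.memLp i _ s) (h.memLp i _ t)

lemma variance_centered (h : IsFunctionalSamples P y η Γ) (i : Fin k) (j : Fin (N i)) (t : T) :
    Var[fun ω => y i j t ω - η i t; P] = Γ i t t := by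
  rw [variance_of_integral_eq_zero (h.memLp i j t).aestronglyMeasurable.aemeasurable
    (h.mean_zero i j t), ← h.integral_sq_eq i j t]

lemma iIndepFun_centered (h : IsFunctionalSamples P y η Γ) (i : Fin k) (s t : T) :
    iIndepFun (fun (j : Fin (N i)) ω => (y i j s ω - η i s, y i j t ω - η i t)) P := by
  have h1 := h.indep.precomp (g := fun j : Fin (N i) => (⟨i, j⟩ : (i : Fin k) × Fin (N i)))
    (fun _ _ hjj => by simpa using hjj)
  exact h1.comp (fun _ f => (f s - η i s, f t - η i t)) fun _ => by fun_prop

lemma lintegral_covError_sq_le [IsProbabilityMeasure P] (h : IsFunctionalSamples P y η Γ)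
    (hG : GaussianSamples P y) (hN : ∀ i, 2 ≤ N i) (i : Fin k) (p : T × T) :
    ∫⁻ ω, ENNReal.ofReal (covError (fun i j t => y i j t ω) Γ i p ^ 2) ∂P ≤
      ENNReal.ofReal (covConst * (Γ i p.1 p.1 * Γ i p.2 p.2)) := by
  obtain ⟨h1, h2⟩ := integral_sq_sum_mul_sub_le (hN i)
    (fun j => hasGaussianLaw_centered hG η i j p.1) (fun j => hasGaussianLaw_centered hG η i j p.2)
    (fun j => h.mean_zero i j p.1) (fun j => h.mean_zero i j p.2)
    (fun j => h.variance_centered i j p.1) (fun j => h.variance_centered i j p.2)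
    (fun j => h.integral_mul_eq i j p.1 p.2) ((h.isDiagDominated hN i).sq_le p.1 p.2)
    (h.iIndepFun_centered i p.1 p.2)
  have h3 : (2 : ℝ) ≤ N i := by exact_mod_cast hN i
  have h4 : 0 < (N i : ℝ) - 1 := by linarith
  simp only [covError_eq y η Γ hN]
  rw [← ofReal_integral_eq_lintegral_ofReal (h1.const_mul _)
    (.of_forall fun ω => mul_nonneg (inv_nonneg.2 h4.le) (sq_nonneg _)), integral_const_mul]
  exact ENNReal.ofReal_le_ofReal ((inv_mul_le_iff₀ h4).2 h2)

lemma measurable_covError [IsProbabilityMeasure P] (h : IsFunctionalSamples P y η Γ)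
    (hN : ∀ i, 2 ≤ N i) (i : Fin k) :
    Measurable fun q : Ω × (T × T) => covError (fun i j t => y i j t q.1) Γ i q.2 := by
  have h1 : ∀ j, Measurable fun q : Ω × (T × T) => y i j q.2.1 q.1 := fun j =>
    (h.measurable i j).comp ((measurable_fst.comp measurable_snd).prodMk measurable_fst)
  have h2 : ∀ j, Measurable fun q : Ω × (T × T) => y i j q.2.2 q.1 := fun j =>
    (h.measurable i j).comp ((measurable_snd.comp measurable_snd).prodMk measurable_fst)
  have h3 : Measurable fun q : Ω × (T × T) => Γ i q.2.1 q.2.2 :=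
    (h.measurable_cov hN i).comp measurable_snd
  have key : ∀ (u w : Fin (N i) → Ω × (T × T) → ℝ) (v : Ω × (T × T) → ℝ),
      (∀ j, Measurable (u j)) → (∀ j, Measurable (w j)) → Measurable v → Measurable fun q =>
        √((N i : ℝ) - 1) * (((N i : ℝ) - 1)⁻¹ *
        ∑ j, (u j q - (N i : ℝ)⁻¹ * ∑ j, u j q) * (w j q - (N i : ℝ)⁻¹ * ∑ j, w j q) -
          v q) := fun u w v hu hw hv => by fun_prop
  exact key _ _ _ h1 h2 h3

/-- After Tonelli the pointwise bound `covConst * (Γ_i(s,s) Γ_i(t,t))` integrates to a multiple of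
`tr²(Γ_i)`, free of the sample sizes. -/
lemma lintegral_lintegral_covError_sq_le [SFinite (volume : Measure T)]
    [IsProbabilityMeasure P] (h : IsFunctionalSamples P y η Γ) (hG : GaussianSamples P y)
    (hN : ∀ i, 2 ≤ N i) {S : ℝ}
    (hS : ∀ i, tr (Γ i) ≤ S) :
    ∫⁻ ω, (∫⁻ p : T × T,
        ENNReal.ofReal (∑ i, covError (fun i j t => y i j t ω) Γ i p ^ 2)) ∂P ≤
      ENNReal.ofReal (k * (covConst * S ^ 2)) := by
  have key : ∀ i, ∫⁻ p : T × T, ∫⁻ ω,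
      ENNReal.ofReal (covError (fun i j t => y i j t ω) Γ i p ^ 2) ∂P ≤
        ENNReal.ofReal (covConst * S ^ 2) := fun i => by
    have hd := h.isDiagDominated hN i
    have hi : Integrable fun p : T × T => Γ i p.1 p.1 * Γ i p.2 p.2 :=
      (h.trace i).mul_prod (h.trace i)
    have h0 : 0 ≤ tr (Γ i) := integral_nonneg hd.nonneg
    calc _ ≤ ∫⁻ p : T × T, ENNReal.ofReal (covConst * (Γ i p.1 p.1 * Γ i p.2 p.2)) :=
          lintegral_mono fun p => h.lintegral_covError_sq_le hG hN i p
      _ = ENNReal.ofReal (covConst * tr (Γ i) ^ 2) := by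
          rw [← ofReal_integral_eq_lintegral_ofReal (hi.const_mul _)
            (.of_forall fun p => mul_nonneg covConst_nonneg
              (mul_nonneg (hd.nonneg _) (hd.nonneg _))), integral_const_mul]
          congr 2
          rw [Measure.volume_eq_prod, integral_prod_mul (fun s => Γ i s s) fun t => Γ i t t,
            ← tr, pow_two]
      _ ≤ _ := by
          have := covConst_nonneg
          have := hS i
          gcongr
  simp only [ENNReal.ofReal_sum_of_nonneg fun i _ => sq_nonneg _]
  rw [lintegral_lintegral_sum_swap fun i =>
    ((h.measurable_covError hN i).pow_const 2).ennreal_ofReal]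
  calc _ ≤ ∑ i : Fin k, ENNReal.ofReal (covConst * S ^ 2) := Finset.sum_le_sum fun i _ => key i
    _ = _ := by
        rw [Finset.sum_const, Finset.card_univ, Fintype.card_fin, nsmul_eq_mul,
          ENNReal.ofReal_mul (Nat.cast_nonneg k), ENNReal.ofReal_natCast]

lemma measurable_pooledCov_diag (h : IsFunctionalSamples P y η Γ) :
    Measurable fun q : Ω × T => pooledCov (fun i j t => y i j t q.1) q.2 q.2 := by
  have h1 : ∀ i j, Measurable fun q : Ω × T => y i j q.2 q.1 := fun i j =>
    (h.measurable i j).comp measurable_swap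
  have key : ∀ u : (i : Fin k) → Fin (N i) → Ω × T → ℝ, (∀ i j, Measurable (u i j)) →
      Measurable fun q => (∑ i, ((N i : ℝ) - 1) * (((N i : ℝ) - 1)⁻¹ *
        ∑ j, (u i j q - (N i : ℝ)⁻¹ * ∑ j, u i j q) * (u i j q - (N i : ℝ)⁻¹ * ∑ j, u i j q))) /
          ((totalSize N : ℝ) - k) := fun u hu => by fun_prop
  exact key _ h1

lemma lintegral_lintegral_pooledCov_le [SFinite (volume : Measure T)]
    [IsProbabilityMeasure P] (h : IsFunctionalSamples P y η Γ) (hN : ∀ i, 2 ≤ N i)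
    (hM : 0 < (totalSize N : ℝ) - k) {S : ℝ} (hS0 : 0 ≤ S) (hS : ∀ i, tr (Γ i) ≤ S) :
    ∫⁻ ω, (∫⁻ t, ENNReal.ofReal (pooledCov (fun i j t => y i j t ω) t t)) ∂P ≤
      ENNReal.ofReal (2 * S) := by
  rw [lintegral_lintegral_swap h.measurable_pooledCov_diag.ennreal_ofReal.aemeasurable]
  have hi : Integrable fun t => (∑ p : (i : Fin k) × Fin (N i), Γ p.1 t t) /
      ((totalSize N : ℝ) - k) :=
    (integrable_finsetSum _ fun p _ => h.trace p.1).div_const _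
  -- Dropping the mean correction leaves `n` terms over the divisor `n - k`; with all `n_i ≥ 2` this
  -- costs the factor `2`.
  have hn : (totalSize N : ℝ) ≤ 2 * ((totalSize N : ℝ) - k) := by
    rw [totalSize_sub, Finset.mul_sum]
    simp only [totalSize, Nat.cast_sum]
    refine Finset.sum_le_sum fun i _ => ?_
    have : (2 : ℝ) ≤ N i := by exact_mod_cast hN i
    linarith
  calc _ ≤ ∫⁻ t, ENNReal.ofReal ((∑ p : (i : Fin k) × Fin (N i), Γ p.1 t t) /
          ((totalSize N : ℝ) - k)) := lintegral_mono fun t => by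
        have hq : ∀ p : (i : Fin k) × Fin (N i),
            Integrable (fun ω => (y p.1 p.2 t ω - η p.1 t) ^ 2) P := fun p =>
          (h.memLp p.1 p.2 t).integrable_sq
        calc _ ≤ ∫⁻ ω, ENNReal.ofReal ((∑ p : (i : Fin k) × Fin (N i),
              (y p.1 p.2 t ω - η p.1 t) ^ 2) / ((totalSize N : ℝ) - k)) ∂P :=
              lintegral_mono fun ω => ENNReal.ofReal_le_ofReal (by
                rw [← pooledCov_sub (fun i j t => y i j t ω) η fun i => by
                  have := hN i; omega]
                exact pooledCov_diag_le _ hN t)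
          _ = _ := by
              rw [← ofReal_integral_eq_lintegral_ofReal
                ((integrable_finsetSum _ fun p _ => hq p).div_const _)
                (.of_forall fun ω => div_nonneg (Finset.sum_nonneg fun p _ => sq_nonneg _)
                  hM.le), integral_div, integral_finsetSum _ fun p _ => hq p]
              simp only [h.integral_sq_eq]
    _ = ENNReal.ofReal ((∑ p : (i : Fin k) × Fin (N i), tr (Γ p.1)) /
          ((totalSize N : ℝ) - k)) := by
        rw [← ofReal_integral_eq_lintegral_ofReal hi (.of_forall fun t =>
          div_nonneg (Finset.sum_nonneg fun p _ => (h.isDiagDominated hN p.1).nonneg t) hM.le),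
          integral_div, integral_finsetSum _ fun p _ => h.trace p.1]
        rfl
    _ ≤ _ := by
        refine ENNReal.ofReal_le_ofReal ((div_le_iff₀ hM).2 ?_)
        calc ∑ p : (i : Fin k) × Fin (N i), tr (Γ p.1)
            ≤ ∑ p : (i : Fin k) × Fin (N i), S := Finset.sum_le_sum fun p _ => hS p.1
          _ = totalSize N * S := by simp [totalSize]
          _ ≤ _ := by nlinarith

end IsFunctionalSamples

/-! ### From mean errors to a bound for the power -/

lemma measure_le_of_lintegral_le {f : Ω → ENNReal} (hf : Measurable f) {C R : ℝ} (hR : 0 < R)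
    (h : ∫⁻ ω, f ω ∂P ≤ ENNReal.ofReal C) :
    P {ω | ENNReal.ofReal R ≤ f ω} ≤ ENNReal.ofReal (C / R) := by
  rw [ENNReal.ofReal_div_of_pos hR]
  exact (meas_ge_le_lintegral_div hf.aemeasurable (by simpa using hR)
    ENNReal.ofReal_ne_top).trans (ENNReal.div_le_div_right h _)

/-- Up to the factor `√(n_i - 1)`, `d_i` is the difference of two covariance functions of finite
trace, each square integrable by diagonal domination. -/
lemma memLp_of_localAlt [SFinite (volume : Measure T)] [IsProbabilityMeasure P] {γ : T → T → ℝ}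
    (hγ : IsCovFun γ)
    {d : Fin k → T → T → ℝ} (h : IsFunctionalSamples P y η (localAlt γ N d))
    (hN : ∀ i, 2 ≤ N i) (i : Fin k) : MemLp (fun p : T × T => d i p.1 p.2) 2 := by
  have h1 := (h.isDiagDominated hN i).memLp_two (h.measurable_cov hN i) (h.trace i)
  have h2 := hγ.isDiagDominated.memLp_two hγ.measurable hγ.trace
  have hb : √((N i : ℝ) - 1) ≠ 0 := by
    have : (2 : ℝ) ≤ N i := by exact_mod_cast hN i
    exact (Real.sqrt_pos.2 (by linarith)).ne'
  refine ((h1.sub h2).const_mul (√((N i : ℝ) - 1))).ae_eq (.of_forall fun p => ?_)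
  simp only [localAlt, Pi.sub_apply]
  field_simp
  ring

/-- A finite-sample lower bound for the power. -/
lemma one_sub_le_measure_rejects [SFinite (volume : Measure T)] [IsProbabilityMeasure P]
    (hN : ∀ i, 2 ≤ N i) (hk : 1 ≤ k) (hM : (2 : ℝ) ≤ (totalSize N : ℝ) - k)
    {τ : Fin k → ℝ} {U : Matrix (Fin k) (Fin k) ℝ} (hU : IsDecomposition τ U)
    (φ : HilbertBasis ℕ ℝ (Lp ℝ 2 (volume : Measure (T × T))))
    {γ : T → T → ℝ} (hγ : IsCovFun γ) {d : Fin k → T → T → ℝ}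
    (h : IsFunctionalSamples P y η (localAlt γ N d)) (hG : GaussianSamples P y)
    {S : ℝ} (hS0 : 0 ≤ S) (hS : ∀ i, tr (localAlt γ N d i) ≤ S) {R : ℝ} (hR : 0 < R)
    (me : Method) {α : ℝ} (hα : α ∈ Set.Ioo (0 : ℝ) 1)
    (hδ : 4 * (((k : ℝ) - 1) * (8 * R ^ 2) / α) + 4 * R +
      2 * normSqField (WMatN N - WMat τ) d < maxDeltaSq U φ d) :
    1 - ENNReal.ofReal ((k * (covConst * S ^ 2) + 2 * S) / R) ≤ P (rejects y me α) := by
  set f : Ω → ENNReal := fun ω => ∫⁻ p : T × T,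
    ENNReal.ofReal (∑ i, covError (fun i j t => y i j t ω) (localAlt γ N d) i p ^ 2) with hf
  set g : Ω → ENNReal := fun ω => ∫⁻ t,
    ENNReal.ofReal (pooledCov (fun i j t => y i j t ω) t t) with hg
  have hfm : Measurable f := by
    have : Measurable fun q : Ω × (T × T) => ENNReal.ofReal
        (∑ i, covError (fun i j t => y i j t q.1) (localAlt γ N d) i q.2 ^ 2) :=
      (Finset.measurable_sum _ fun i _ =>
        (h.measurable_covError hN i).pow_const 2).ennreal_ofReal
    exact this.lintegral_prod_right'
  have hgm : Measurable g :=
    h.measurable_pooledCov_diag.ennreal_ofReal.lintegral_prod_right'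
  have h1 := measure_le_of_lintegral_le hfm hR (h.lintegral_lintegral_covError_sq_le hG hN hS)
  have h2 := measure_le_of_lintegral_le hgm hR
    (h.lintegral_lintegral_pooledCov_le hN (by linarith) hS0 hS)
  -- Covering the whole space uses only subadditivity, so the rejection event need not be
  -- measurable.
  have hcover : (Set.univ : Set Ω) ⊆ rejects y me α ∪
      ({ω | ENNReal.ofReal R ≤ f ω} ∪ {ω | ENNReal.ofReal R ≤ g ω}) := by
    intro ω _
    by_cases h3 : ENNReal.ofReal R ≤ f ω
    · exact Or.inr (Or.inl h3)
    by_cases h4 : ENNReal.ofReal R ≤ g ω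
    · exact Or.inr (Or.inr h4)
    · refine Or.inl (critValue_lt_testStat (fun i j t => y i j t ω)
        (fun i j => (h.measurable i j).comp measurable_prodMk_right) hN hk hM hU φ γ d
        (memLp_of_localAlt hγ h hN) (h.measurable_cov hN) hR.le (not_le.1 h3).le (not_le.1 h4).le
        me hα hδ)
  have h5 : (1 : ENNReal) ≤ P (rejects y me α) +
      ENNReal.ofReal ((k * (covConst * S ^ 2) + 2 * S) / R) :=
    calc 1 = P Set.univ := measure_univ.symm
      _ ≤ _ := (measure_mono hcover).trans (measure_union_le _ _)
      _ ≤ P (rejects y me α) + (ENNReal.ofReal (k * (covConst * S ^ 2) / R) +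
          ENNReal.ofReal (2 * S / R)) := by
          gcongr
          exact (measure_union_le _ _).trans (add_le_add h1 h2)
      _ = _ := by
          have := covConst_nonneg
          rw [← ENNReal.ofReal_add (by positivity) (by positivity), add_div]
  exact tsub_le_iff_right.2 h5

end Samples

/-! ### Asymptotics -/

section Asymptotics

variable {k : ℕ} {n : ℕ → Fin k → ℕ} {τ : Fin k → ℝ}

namespace ProportionalSizes

lemma one_le (hn : ProportionalSizes n τ) : 1 ≤ k := by
  by_contra! h
  obtain rfl : k = 0 := by omega
  obtain ⟨ν, hν⟩ := (hn.total.eventually_ge_atTop 1).exists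
  simp [totalSize] at hν

lemma tendsto_total (hn : ProportionalSizes n τ) :
    Tendsto (fun ν => (totalSize (n ν) : ℝ)) atTop atTop :=
  tendsto_natCast_atTop_atTop.comp hn.total

lemma tendsto_size (hn : ProportionalSizes n τ) (i : Fin k) :
    Tendsto (fun ν => (n ν i : ℝ)) atTop atTop := by
  refine ((hn.ratio i).pos_mul_atTop (hn.mem_Ioo i).1 hn.tendsto_total).congr' ?_
  filter_upwards [hn.tendsto_total.eventually_gt_atTop 0] with ν hν
  field_simp

lemma eventually_two_le (hn : ProportionalSizes n τ) :
    ∀ᶠ ν in atTop, (2 : ℝ) ≤ (totalSize (n ν) : ℝ) - k := by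
  filter_upwards [hn.tendsto_total.eventually_ge_atTop (2 + k)] with ν hν
  linarith

lemma tendsto_ratio_sub (hn : ProportionalSizes n τ) (i : Fin k) :
    Tendsto (fun ν => ((n ν i : ℝ) - 1) / ((totalSize (n ν) : ℝ) - k)) atTop (𝓝 (τ i)) := by
  have h0 : ∀ c : ℝ, Tendsto (fun ν => c / (totalSize (n ν) : ℝ)) atTop (𝓝 0) := fun c =>
    hn.tendsto_total.const_div_atTop c
  have h1 := ((hn.ratio i).sub (h0 1)).div ((tendsto_const_nhds (x := (1 : ℝ))).sub (h0 k))
    (by norm_num)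
  simp only [sub_zero, div_one] at h1
  refine h1.congr' ?_
  filter_upwards [hn.tendsto_total.eventually_gt_atTop 0] with ν hν
  rw [Pi.div_apply]
  field_simp

lemma tendsto_WMatN (hn : ProportionalSizes n τ) (i j : Fin k) :
    Tendsto (fun ν => (WMatN (n ν) - WMat τ) i j) atTop (𝓝 0) := by
  have h1 : Tendsto (fun ν => √(((n ν i : ℝ) - 1) / ((totalSize (n ν) : ℝ) - k)) *
      √(((n ν j : ℝ) - 1) / ((totalSize (n ν) : ℝ) - k))) atTop (𝓝 (√(τ i) * √(τ j))) :=
    (hn.tendsto_ratio_sub i).sqrt.mul (hn.tendsto_ratio_sub j).sqrt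
  have h2 := (tendsto_const_nhds (x := √(τ i) * √(τ j))).sub h1
  rw [sub_self] at h2
  refine h2.congr' ?_
  filter_upwards [hn.eventually_two_le] with ν hν
  have hM : 0 ≤ (totalSize (n ν) : ℝ) - k := by linarith
  have hs : √((totalSize (n ν) : ℝ) - k) * √((totalSize (n ν) : ℝ) - k) =
    (totalSize (n ν) : ℝ) - k := Real.mul_self_sqrt hM
  simp only [WMatN, WMat, Matrix.sub_apply, Matrix.smul_apply, Matrix.vecMulVec_apply,
    smul_eq_mul, Real.sqrt_div' _ hM]
  rw [div_mul_div_comm, hs]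
  ring

end ProportionalSizes

variable {T : Type*} [MeasureSpace T]

/-- Cauchy–Schwarz in each row bounds the operator norm of `A` by its Hilbert–Schmidt norm. -/
lemma normSqField_le (A : Matrix (Fin k) (Fin k) ℝ) {d : Fin k → T → T → ℝ}
    (hd : ∀ i, MemLp (fun p : T × T => d i p.1 p.2) 2) :
    normSqField A d ≤
      (∑ i, ∑ j, A i j ^ 2) * ∑ j, ∫ p : T × T, d j p.1 p.2 ^ 2 := by
  have hi := fun j => (hd j).integrable_sq
  rw [normSqField, Finset.sum_mul, ← integral_finsetSum _ fun j _ => hi j]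
  refine Finset.sum_le_sum fun i _ => ?_
  rw [← integral_const_mul]
  exact integral_mono_of_nonneg (.of_forall fun p => sq_nonneg _)
    ((integrable_finsetSum _ fun j _ => hi j).const_mul _)
    (.of_forall fun p =>
      Finset.sum_mul_sq_le_sq_mul_sq Finset.univ (A i) fun j => d j p.1 p.2)

lemma normSqField_nonneg (A : Matrix (Fin k) (Fin k) ℝ) (d : Fin k → T → T → ℝ) :
    0 ≤ normSqField A d :=
  Finset.sum_nonneg fun _ _ => integral_nonneg fun _ => sq_nonneg _

lemma ProportionalSizes.tendsto_normSqField (hn : ProportionalSizes n τ)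
    {d : Fin k → T → T → ℝ} (hd : ∀ i, MemLp (fun p : T × T => d i p.1 p.2) 2) :
    Tendsto (fun ν => normSqField (WMatN (n ν) - WMat τ) d) atTop (𝓝 0) := by
  have h : Tendsto (fun ν => (∑ i, ∑ j, (WMatN (n ν) - WMat τ) i j ^ 2) *
      ∑ j, ∫ p : T × T, d j p.1 p.2 ^ 2) atTop (𝓝 0) := by
    have h1 : Tendsto (fun ν => ∑ i, ∑ j, (WMatN (n ν) - WMat τ) i j ^ 2) atTop
        (𝓝 (∑ _i : Fin k, ∑ _j : Fin k, (0 : ℝ) ^ 2)) :=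
      tendsto_finsetSum _ fun i _ => tendsto_finsetSum _ fun j _ => (hn.tendsto_WMatN i j).pow 2
    simpa using h1.mul_const (∑ j, ∫ p : T × T, d j p.1 p.2 ^ 2)
  exact squeeze_zero (fun ν => normSqField_nonneg _ _) (fun ν => normSqField_le _ hd) h

/-- For a fixed alternative the traces converge to that of `γ`. -/
lemma ProportionalSizes.eventually_tr_le (hn : ProportionalSizes n τ) {γ : T → T → ℝ}
    (hγ : IsCovFun γ) {d : Fin k → T → T → ℝ}
    (h : ∃ ν, ∀ i, Integrable fun t => localAlt γ (n ν) d i t t) :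
    ∀ᶠ ν in atTop, ∀ i, tr (localAlt γ (n ν) d i) ≤ tr γ + 1 := by
  obtain ⟨ν₀, h₀⟩ := h
  refine eventually_all.2 fun i => ?_
  -- Because `d` does not depend on `ν`, a single admissible sample size shows that its diagonal is
  -- integrable.
  have hd : Integrable fun t => d i t t := by
    have hb : √((n ν₀ i : ℝ) - 1) ≠ 0 := by
      have : (2 : ℝ) ≤ n ν₀ i := by exact_mod_cast hn.two_le ν₀ i
      exact (Real.sqrt_pos.2 (by linarith)).ne'
    refine (((h₀ i).sub hγ.trace).const_mul (√((n ν₀ i : ℝ) - 1))).congr (.of_forall fun t => ?_)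
    simp only [localAlt, Pi.sub_apply]
    field_simp
    ring
  have heq : ∀ ν, tr (localAlt γ (n ν) d i) =
      tr γ + (√((n ν i : ℝ) - 1))⁻¹ * ∫ t, d i t t := fun ν => by
    simp only [tr, localAlt]
    rw [integral_add hγ.trace (hd.const_mul _), integral_const_mul]
  have hlim : Tendsto (fun ν => tr (localAlt γ (n ν) d i)) atTop (𝓝 (tr γ)) := by
    simp only [heq]
    have h1 : Tendsto (fun ν => √((n ν i : ℝ) - 1)) atTop atTop :=
      Real.tendsto_sqrt_atTop.comp (tendsto_atTop_add_const_right _ (-1) (hn.tendsto_size i))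
    simpa using (h1.inv_tendsto_atTop.mul_const (∫ t, d i t t)).const_add (tr γ)
  filter_upwards [hlim.eventually_lt_const (lt_add_one (tr γ))] with ν hν using hν.le

lemma tendsto_one_of_forall_sub_le {ι : Type*} {l : Filter ι} {u : ι → ENNReal}
    (h1 : ∀ x, u x ≤ 1) (h : ∀ ε : ℝ, 0 < ε → ∀ᶠ x in l, 1 - ENNReal.ofReal ε ≤ u x) :
    Tendsto u l (𝓝 1) := by
  rw [ENNReal.tendsto_nhds ENNReal.one_ne_top]
  intro ε hε
  by_cases hε' : ε = ⊤
  · simp [hε']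
  · filter_upwards [h ε.toReal (ENNReal.toReal_pos hε.ne' hε')] with x hx
    rw [ENNReal.ofReal_toReal hε'] at hx
    exact ⟨hx, (h1 x).trans le_self_add⟩

/-- The power is close to `1`, uniformly over all models with bounded traces, when `max_r δ_r²` is
large. -/
lemma exists_threshold [SFinite (volume : Measure T)] (hk : 1 ≤ k)
    {U : Matrix (Fin k) (Fin k) ℝ} (hU : IsDecomposition τ U)
    (φ : HilbertBasis ℕ ℝ (Lp ℝ 2 (volume : Measure (T × T))))
    {γ : T → T → ℝ} (hγ : IsCovFun γ) (me : Method) {α : ℝ} (hα : α ∈ Set.Ioo (0 : ℝ) 1)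
    {S : ℝ} (hS0 : 0 ≤ S) {ε : ℝ} (hε : 0 < ε) :
    ∃ L : ℝ, ∀ {N : Fin k → ℕ} {Ω : Type u} [MeasurableSpace Ω] {P : Measure Ω}
      [IsProbabilityMeasure P] {y : (i : Fin k) → Fin (N i) → T → Ω → ℝ} {η : Fin k → T → ℝ}
      {d : Fin k → T → T → ℝ}, (∀ i, 2 ≤ N i) → (2 : ℝ) ≤ (totalSize N : ℝ) - k →
      IsFunctionalSamples P y η (localAlt γ N d) → GaussianSamples P y →
      (∀ i, tr (localAlt γ N d i) ≤ S) →
      L + 2 * normSqField (WMatN N - WMat τ) d < maxDeltaSq U φ d →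
      1 - ENNReal.ofReal ε ≤ P (rejects y me α) := by
  have hC : 0 ≤ k * (covConst * S ^ 2) + 2 * S := by
    have := covConst_nonneg
    positivity
  set C := k * (covConst * S ^ 2) + 2 * S with hC_def
  -- The radius `R = C / ε + 1` makes the exceptional probability `C / R` at most `ε`; the `1` keeps
  -- it positive when `C = 0`.
  have hR : 0 < C / ε + 1 := by positivity
  have hCR : C / (C / ε + 1) ≤ ε := by
    rw [div_le_iff₀ hR, mul_add, mul_div_cancel₀ _ hε.ne']
    linarith
  refine ⟨4 * (((k : ℝ) - 1) * (8 * (C / ε + 1) ^ 2) / α) + 4 * (C / ε + 1), ?_⟩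
  intro N Ω _ P _ y η d hN hM h hG hS hδ
  refine le_trans ?_ (one_sub_le_measure_rejects hN hk hM hU φ hγ h hG hS0 hS hR me hα hδ)
  exact tsub_le_tsub_left (ENNReal.ofReal_le_ofReal hCR) _

end Asymptotics

end ECF

/-- The functions `d_i` are fixed, i.e. do not depend on the sample sizes, in the first part, where
`n → ∞` first and `max_r δ_r² → ∞` afterwards (for fixed `d_i` the functions
`γ + (n_i - 1)^{-1/2} d_i` need be covariance functions only once `n` is large). In the second
part they vary with `n`, and `max_r δ_r² → ∞` as `n → ∞`; the replacement of `W_n` by its limit `W` must then be negligible on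
`d`, which it always is when `d` is fixed. -/
theorem theorem5 {a b : ℝ} (hab : a < b) {k : ℕ}
    (n : ℕ → Fin k → ℕ) (τ : Fin k → ℝ) (hn : ECF.ProportionalSizes n τ)
    (γ : Set.Icc a b → Set.Icc a b → ℝ) (hγ : ECF.IsCovFun γ)
    (U : Matrix (Fin k) (Fin k) ℝ) (hU : ECF.IsDecomposition τ U)
    (ev : ℕ → ℝ)
    (φ : HilbertBasis ℕ ℝ (Lp ℝ 2 (volume : Measure (Set.Icc a b × Set.Icc a b))))
    (hφ : ECF.IsEigensystem γ ev φ)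
    (α : ℝ) (hα : α ∈ Set.Ioo (0 : ℝ) 1) (me : ECF.Method) :
    (∀ (d : ℕ → Fin k → Set.Icc a b → Set.Icc a b → ℝ)
      (Ω : ℕ → ℕ → Type u) [∀ m ν, MeasurableSpace (Ω m ν)]
      (P : ∀ m ν, Measure (Ω m ν)) [∀ m ν, IsProbabilityMeasure (P m ν)]
      (η : ℕ → ℕ → Fin k → Set.Icc a b → ℝ)
      (y : ∀ m ν, (i : Fin k) → Fin (n ν i) → Set.Icc a b → Ω m ν → ℝ),
      (∀ m, ∀ᶠ ν in atTop,
        ECF.IsFunctionalSamples (P m ν) (y m ν) (η m ν) (ECF.localAlt γ (n ν) (d m))) →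
      (∀ m, ∀ᶠ ν in atTop, ECF.GaussianSamples (P m ν) (y m ν)) →
      (∀ m, ECF.UniformlyBounded fun ν => ECF.localAlt γ (n ν) (d m)) →
      Tendsto (fun m => ECF.maxDeltaSq U φ (d m)) atTop atTop →
      Tendsto (fun m => liminf (fun ν => P m ν (ECF.rejects (y m ν) me α)) atTop) atTop (𝓝 1)) ∧
    (∀ (d : ℕ → Fin k → Set.Icc a b → Set.Icc a b → ℝ)
      (Ω : ℕ → Type u) [∀ ν, MeasurableSpace (Ω ν)]
      (P : ∀ ν, Measure (Ω ν)) [∀ ν, IsProbabilityMeasure (P ν)]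
      (η : ℕ → Fin k → Set.Icc a b → ℝ)
      (y : ∀ ν, (i : Fin k) → Fin (n ν i) → Set.Icc a b → Ω ν → ℝ),
      (∀ᶠ ν in atTop,
        ECF.IsFunctionalSamples (P ν) (y ν) (η ν) (ECF.localAlt γ (n ν) (d ν))) →
      (∀ᶠ ν in atTop, ECF.GaussianSamples (P ν) (y ν)) →
      (ECF.UniformlyBounded fun ν => ECF.localAlt γ (n ν) (d ν)) →
      Tendsto (fun ν => ECF.maxDeltaSq U φ (d ν)) atTop atTop →
      Tendsto (fun ν => ECF.normSqField (ECF.WMatN (n ν) - ECF.WMat τ) (d ν) /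
        ECF.maxDeltaSq U φ (d ν)) atTop (𝓝 0) →
      Tendsto (fun ν => P ν (ECF.rejects (y ν) me α)) atTop (𝓝 1)) := by
  have hfin : IsFiniteMeasure (volume : Measure (Set.Icc a b)) := by
    refine ⟨?_⟩
    rw [Measure.Subtype.volume_univ measurableSet_Icc.nullMeasurableSet]
    exact measure_Icc_lt_top
  have hk := hn.one_le
  constructor
  · intro d Ω _ P _ η y hy hG _ hδ
    -- The bound `tr γ + 1` is the same for all `m`, since for each fixed `d` the traces converge to
    -- `tr γ`. Hence `L` can be chosen before `m`.
    have hS0 : 0 ≤ ECF.tr γ + 1 := by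
      have : 0 ≤ ECF.tr γ := integral_nonneg hγ.isDiagDominated.nonneg
      linarith
    refine ECF.tendsto_one_of_forall_sub_le (fun m => ?_) fun ε hε => ?_
    · exact (liminf_le_liminf (.of_forall fun ν => prob_le_one)).trans_eq (liminf_const 1)
    obtain ⟨L, hL⟩ := ECF.exists_threshold.{u} hk hU φ hγ me hα hS0 hε
    -- The margin `2` absorbs `2 ‖(W_n - W) d‖²`, which for fixed `d` is eventually below `2`.
    filter_upwards [hδ.eventually_gt_atTop (L + 2)] with m hm
    obtain ⟨ν₀, hν₀⟩ := (hy m).exists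
    have hd := ECF.memLp_of_localAlt hγ hν₀ (hn.two_le ν₀)
    refine le_liminf_of_le (by isBoundedDefault) ?_
    filter_upwards [hy m, hG m, hn.eventually_two_le,
      hn.eventually_tr_le hγ ⟨ν₀, hν₀.trace⟩,
      (hn.tendsto_normSqField hd).eventually_lt_const one_pos] with ν h1 h2 h3 h4 h5
    exact hL (hn.two_le ν) h3 h1 h2 h4 (by linarith)
  · intro d Ω _ P _ η y hy hG hB hδ hW
    obtain ⟨C, hC⟩ := hB
    refine ECF.tendsto_one_of_forall_sub_le (fun ν => prob_le_one) fun ε hε => ?_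
    -- Here `d` may grow with `n`, so the traces are controlled by the uniform bound `C` and the
    -- finite length of the interval.
    have hS0 : 0 ≤ |C| * (volume : Measure (Set.Icc a b)).real Set.univ := by positivity
    obtain ⟨L, hL⟩ := ECF.exists_threshold.{u} hk hU φ hγ me hα hS0 hε
    -- Half of `max_r δ_r²` exceeds `L`, and the ratio below `1 / 4` keeps `2 ‖(W_n - W) d‖²` under
    -- the other half. Positivity allows clearing the denominator.
    filter_upwards [hy, hG, hn.eventually_two_le, hδ.eventually_gt_atTop (max (2 * L) 0),
      hW.eventually_lt_const (show (0 : ℝ) < 1 / 4 by norm_num)] with ν h1 h2 h3 h4 h5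
    have hpos := (le_max_right _ _).trans_lt h4
    have hL' := (le_max_left _ _).trans_lt h4
    rw [div_lt_iff₀ hpos] at h5
    refine hL (hn.two_le ν) h3 h1 h2 (fun i => ?_) (by linarith)
    calc ECF.tr (ECF.localAlt γ (n ν) (d ν) i) ≤ ∫ _t : Set.Icc a b, |C| :=
          integral_mono (h1.trace i) (integrable_const _) fun t =>
            (le_abs_self _).trans ((hC ν i t t).trans (le_abs_self C))
      _ = _ := by rw [integral_const, smul_eq_mul, mul_comm]
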